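/- Let $D$ be a finite set, $r\ge 1$ and $R\subseteq D^r$. An instance of $\mathrm{CSP}(R)$ on $n$ variables is a set $X$ with $|X|=n$ together with a set $Y\subseteq X^r$ of clauses. An assignment $\sigma:X\to D$ satisfies $y=(y_1,\dots,y_r)\in Y$ if $\sigma(y):=(\sigma(y_1),\dots,\sigma(y_r))\in R$. The instance is non-redundant if for every $y\in Y$ there is an assignment that does not satisfy $y$ but satisfies all clauses in $Y\setminus\{y\}$; $\mathrm{NRD}(R,n)$ is the maximum of $|Y|$ over all non-redundant instances of $\mathrm{CSP}(R)$ on $n$ variables. For $\varepsilon\in(0,1)$, an $\varepsilon$-sparsifier of $(X,Y)$ is a map $w:Y\to\mathbb{R}_{\ge 0}$ such that, for every $\sigma:X\to D$, $$(1-\varepsilon)\,|\{y\in Y:\sigma(y)\in R\}|\ \le\ \sum_{y\in Y,\ \sigma(y)\in R} w(y)\ \le\ (1+\varepsilon)\,|\{y\in Y:\sigma(y)\in R\}|;$$ the $\varepsilon$-sparsity of $(X,Y)$ is the minimum of $|\{y\in Y : w(y)>0\}|$ over all its $\varepsilon$-sparsifiers $w$, and $\mathrm{SPR}(R,n,\varepsilon)$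 is the maximum $\varepsilon$-sparsity of an instance of $\mathrm{CSP}(R)$ on $n$ variables. **Theorem.** Let $P=\{(x,y,z)\in(\mathbb{Z}/3\mathbb{Z})^3: x+y+z=0\}\setminus\{(0,0,0)\}$ and $\overline{P}=(\mathbb{Z}/3\mathbb{Z})^3\setminus P$. There are absolute constants $c,C>0$ and $k\in\mathbb{N}$ such that 1. $c\,n^{1.5}\le \mathrm{NRD}(P,n)$ for all $n\ge 0$, and $\mathrm{NRD}(P,n)\le C\,n^{1.6}(\log n)^k$ for all $n\ge 2$; 2. for all $\varepsilon\in(0,1)$, $c\,n^{1.5}\le \mathrm{SPR}(\overline{P},n,\varepsilon)$ for all $n\ge 0$, and $\mathrm{SPR}(\overline{P},n,\varepsilon)\le C\,n^{1.6}(\log n)^k/\varepsilon^2$ for all $n\ge 2$. In particular, the exponents are non-integral: $$1<\liminf_{n\to\infty}\frac{\log \mathrm{NRD}(P,n)}{\log n}\le\limsup_{n\to\infty}\frac{\log \mathrm{NRD}(P,n)}{\log n}<2,$$ and likewise with $\mathrm{SPR}(\overline{P},n,\varepsilon)$ in place of $\mathrm{NRD}(P,n)$, for every fixed $\varepsilon\in(0,1)$.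 -/

import Mathlib

open scoped NNReal

namespace CSP

/-! An instance of `CSP(R)` for `R ⊆ D ^ r` is a finite set `X` of variables together with a set
`Y ⊆ X ^ r` of clauses (repeated variables inside a clause are allowed).  An assignment is a map
`σ : X → D`, and `σ` satisfies the clause `y` when the tuple `σ ∘ y` lies in `R`. -/

variable {D X : Type*} {r : ℕ}

/-- The set of clauses `Y` is non-redundant for `R`: every clause `y ∈ Y` has an assignment which
violates `y` and satisfies all the other clauses of `Y`. -/
def IsNonRedundant (R : Set (Fin r → D)) (Y : Finset (Fin r → X)) : Prop :=
  ∀ y ∈ Y, ∃ σ : X → D, σ ∘ y ∉ R ∧ ∀ y' ∈ Y, y' ≠ y → σ ∘ y' ∈ R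

open Classical in
/-- `NRD(R, n)`: the maximum number of clauses of a non-redundant instance of `CSP(R)` on `n`
variables. -/
noncomputable def NRD (R : Set (Fin r → D)) (n : ℕ) : ℕ :=
  ((Finset.univ : Finset (Finset (Fin r → Fin n))).filter (IsNonRedundant R)).sup Finset.card

open Classical in
/-- The number of clauses of `Y` that are satisfied by `σ`. -/
noncomputable def wt (R : Set (Fin r → D)) (Y : Finset (Fin r → X)) (σ : X → D) : ℕ :=
  (Y.filter fun y => σ ∘ y ∈ R).card

open Classical in
/-- The total `w`-weight of the clauses of `Y` that are satisfied by `σ`. -/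
noncomputable def weightedWt (R : Set (Fin r → D)) (Y : Finset (Fin r → X)) (w : Y → ℝ≥0)
    (σ : X → D) : ℝ :=
  ∑ y : Y, if σ ∘ (y : Fin r → X) ∈ R then (w y : ℝ) else 0

/-- `w : Y → ℝ≥0` is an `ε`-sparsifier of the instance with clause set `Y` of `CSP(R)`. -/
def IsSparsifier (R : Set (Fin r → D)) (Y : Finset (Fin r → X)) (ε : ℝ) (w : Y → ℝ≥0) : Prop :=
  ∀ σ : X → D, (1 - ε) * wt R Y σ ≤ weightedWt R Y w σ ∧
    weightedWt R Y w σ ≤ (1 + ε) * wt R Y σ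

/-- The `ε`-sparsity of an instance: the minimum support size of an `ε`-sparsifier.  (For `0 ≤ ε`
the constant weight `1` is an `ε`-sparsifier, so that the minimum is over a nonempty set.) -/
noncomputable def sparsity (R : Set (Fin r → D)) (Y : Finset (Fin r → X)) (ε : ℝ) : ℕ :=
  sInf {k : ℕ | ∃ w : Y → ℝ≥0, IsSparsifier R Y ε w ∧ (Function.support w).ncard = k}

/-- `SPR(R, n, ε)`: the maximum `ε`-sparsity of an instance of `CSP(R)` on `n` variables. -/
noncomputable def SPR (R : Set (Fin r → D)) (n : ℕ) (ε : ℝ) : ℕ :=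
  (Finset.univ : Finset (Finset (Fin r → Fin n))).sup fun Y => sparsity R Y ε

/-- The predicate `3LIN_G = {(x, y, z) ∈ G ^ 3 : x + y + z = 0}`. -/
def threeLin (G : Type*) [AddCommGroup G] : Set (Fin 3 → G) :=
  {a | a 0 + a 1 + a 2 = 0}

/-- The predicate `3LIN*_G`, which is `3LIN_G` without the triple `(0, 0, 0)`. -/
def threeLinStar (G : Type*) [AddCommGroup G] : Set (Fin 3 → G) :=
  threeLin G \ {![0, 0, 0]}

end CSP

namespace CSP

/-! ### Lower bounds: the cube instance. -/

section LowerBound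

variable {D : Type*} {r : ℕ}

/-! Both lower bounds use one instance: clauses (x_{ab}, y_{bc}, z_{ac}) on 3m² variables. The
values u_a - v_b, v_b - w_c, w_c - u_a solve every equation, and u, v, w can be chosen to agree at a
single triple only (`exists_isNonRedundant_cube`). A non-redundancy witness for P satisfies exactly
one clause of the complement, so no sparsifier can drop that clause (`IsNonRedundant.card_le_SPR`).

For the upper bound on `NRD`, at most n clauses have a witness with nonzero sum, by linear
independence. Record each variable as the vector of its values under the witnesses of the other
clauses. These clauses become zero-sum triples of vectors, and triple i vanishes exactly at
coordinate i. Two facts collide. Triples inside a subspace of dimension R number O(R⁴), by the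
polynomial method (`IsMatchingFamily.card_le_of_mem`). In a set of t vectors with E triples that is
densest for exponent 8/5, some subspace of dimension O((t²/E) log t) holds a constant fraction of
the triples (`IsMatchingFamily.exists_dense_subspace`): while the trace of the subspace is poor in
triples, adjoining a popular vector multiplies it by 1 + Ω(E/t²). Hence E ≲ (t²/E)⁴ up to
logarithms, that is E ≲ t^{8/5}.

The upper bound on `SPR` is a general comparison with `NRD` of the complement, up to polylog/ε²
(`SPR_compl_le`). The sets of satisfied clauses form a family whose non-redundant sets have size at
most k = `NRD`. Its closure under unions has at most (m+1)^k members, by shattering. The union of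
two independent random members nearly doubles the conditional variance as long as points are rare,
while the variance never exceeds the logarithm of the size of the closure. So one random member has
little variance and lies in a short list. Multiplicative weights extend this from typical members to
all of them: off a small set of points there are few traces (`NonRedundantLE.exists_few_traces`). A
Chernoff and union bound argument then discards half of the points
(`NonRedundantLE.exists_halving`), and iterating gives the sparsifier. -/

lemma IsNonRedundant.card_le_NRD {R : Set (Fin r → D)} {n : ℕ} {Y : Finset (Fin r → Fin n)}
    (h : IsNonRedundant R Y) : Y.card ≤ NRD R n := by
  classical
  unfold NRD
  exact Finset.le_sup (f := Finset.card) (Finset.mem_filter.2 ⟨Finset.mem_univ _, h⟩)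

lemma isSparsifier_one {X : Type*} (R : Set (Fin r → D)) (Y : Finset (Fin r → X)) {ε : ℝ}
    (hε : 0 ≤ ε) : IsSparsifier R Y ε 1 := by
  classical
  intro σ
  have h : weightedWt R Y 1 σ = wt R Y σ := by
    unfold weightedWt wt
    rw [Finset.card_filter]
    push_cast
    rw [← Finset.sum_coe_sort Y]
    simp
  have h0 : (0 : ℝ) ≤ wt R Y σ := Nat.cast_nonneg _
  rw [h]
  constructor <;> nlinarith

/-- The witness for y satisfies the complement at y alone, so weight zero at y would violate the
lower sparsifier inequality, as ε < 1. -/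
lemma IsNonRedundant.card_le_SPR {R : Set (Fin r → D)} {n : ℕ} {Y : Finset (Fin r → Fin n)}
    (h : IsNonRedundant R Y) {ε : ℝ} (h0 : 0 < ε) (h1 : ε < 1) : Y.card ≤ SPR Rᶜ n ε := by
  classical
  refine le_trans ?_ (Finset.le_sup (f := fun Y => sparsity Rᶜ Y ε) (Finset.mem_univ Y))
  refine le_csInf ⟨_, 1, isSparsifier_one _ _ h0.le, rfl⟩ ?_
  rintro k ⟨w, hw, rfl⟩
  have hsupp : Function.support w = Set.univ := by
    refine Set.eq_univ_of_forall fun y => ?_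
    obtain ⟨σ, hσ, hσ'⟩ := h y y.2
    have hy := (hw σ).1
    intro hwy
    have e1 : wt Rᶜ Y σ = 1 := by
      unfold wt
      rw [Finset.card_eq_one]
      refine ⟨y, ?_⟩
      ext y'
      simp only [Finset.mem_filter, Finset.mem_singleton, Set.mem_compl_iff]
      constructor
      · rintro ⟨hy', hn⟩
        by_contra hne
        exact hn (hσ' y' hy' hne)
      · rintro rfl
        exact ⟨y.2, hσ⟩
    have e2 : weightedWt Rᶜ Y w σ = 0 := by
      unfold weightedWt
      refine Finset.sum_eq_zero fun y' _ => ?_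
      split_ifs with hn
      · have : y' = y := by
          by_contra hne
          exact hn (hσ' y' y'.2 fun e => hne (Subtype.ext e))
        rw [this, hwy]
        simp
      · rfl
    rw [e1, e2] at hy
    norm_num at hy
    linarith
  rw [hsupp, Set.ncard_univ]
  simp

/-- The clauses `(x_{ab}, y_{bc}, z_{ac})` form a non-redundant instance of `3LIN*`. -/
lemma exists_isNonRedundant_cube {m n : ℕ} (h : 3 * m ^ 2 ≤ n) :
    ∃ Y : Finset (Fin 3 → Fin n), IsNonRedundant (threeLinStar (ZMod 3)) Y ∧ Y.card = m ^ 3 := by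
  classical
  have hc : Fintype.card (Fin 3 × Fin m × Fin m) ≤ Fintype.card (Fin n) := by
    simp only [Fintype.card_prod, Fintype.card_fin]
    nlinarith
  obtain ⟨e⟩ := Function.Embedding.nonempty_of_card_le hc
  let cl : Fin m × Fin m × Fin m → (Fin 3 → Fin n) := fun p =>
    ![e (0, p.1, p.2.1), e (1, p.2.1, p.2.2), e (2, p.1, p.2.2)]
  have hinj : Function.Injective cl := by
    rintro ⟨a, b, c⟩ ⟨a', b', c'⟩ hp
    have h0 := congrFun hp 0
    have h1 := congrFun hp 1
    simp only [cl, Matrix.cons_val_zero, Matrix.cons_val_one, EmbeddingLike.apply_eq_iff_eq,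
      Prod.mk.injEq] at h0 h1
    simp [h0.2.1, h1.2.1, h1.2.2]
  refine ⟨Finset.univ.image cl, ?_, ?_⟩
  · intro y hy
    obtain ⟨⟨a, b, c⟩, -, rfl⟩ := Finset.mem_image.1 hy
    -- The values of u and w lie in {0, 1} and those of v in {0, 2}. The three differences vanish
    -- only if u = v = w, which forces the common value 0.
    let u : Fin m → ZMod 3 := fun i => if i = a then 0 else 1
    let v : Fin m → ZMod 3 := fun i => if i = b then 0 else 2
    let w : Fin m → ZMod 3 := fun i => if i = c then 0 else 1
    let τ : Fin 3 × Fin m × Fin m → ZMod 3 := fun q =>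
      ![u q.2.1 - v q.2.2, v q.2.1 - w q.2.2, w q.2.2 - u q.2.1] q.1
    have key : ∀ p : Fin m × Fin m × Fin m, Function.extend e τ 0 ∘ cl p =
        ![u p.1 - v p.2.1, v p.2.1 - w p.2.2, w p.2.2 - u p.1] := by
      intro p
      ext i
      fin_cases i <;> simp [cl, e.injective.extend_apply, τ]
    refine ⟨Function.extend e τ 0, ?_, ?_⟩
    · rw [key]
      simp [u, v, w, threeLinStar]
    · intro y' hy' hne
      obtain ⟨⟨a', b', c'⟩, -, rfl⟩ := Finset.mem_image.1 hy'
      rw [key]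
      refine ⟨?_, ?_⟩
      · simp [threeLin]
      · intro hz
        have h0 := congrFun hz 0
        have h1 := congrFun hz 1
        apply hne
        simp only [u, v, w, Matrix.cons_val_zero, Matrix.cons_val_one] at h0 h1
        have ha : a' = a ∧ b' = b ∧ c' = c := by
          by_cases h1' : a' = a <;> by_cases h2' : b' = b <;> by_cases h3' : c' = c <;>
            simp only [h1', h2', h3', if_true, if_false] at h0 h1 ⊢ <;> revert h0 h1 <;> decide
        rw [ha.1, ha.2.1, ha.2.2]
  · rw [Finset.card_image_of_injective _ hinj]
    simp
    ring

lemma exists_isNonRedundant_large (n : ℕ) :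
    ∃ Y : Finset (Fin 3 → Fin n), IsNonRedundant (threeLinStar (ZMod 3)) Y ∧
      n ^ 3 ≤ 1728 * Y.card ^ 2 := by
  classical
  -- The cube needs three variables; for n = 1, 2 one constant clause, violated by the zero
  -- assignment, is enough.
  rcases Nat.lt_or_ge n 3 with hn | hn
  · rcases Nat.eq_zero_or_pos n with rfl | hpos
    · exact ⟨∅, by intro y hy; simp at hy, by simp⟩
    · refine ⟨{fun _ => ⟨0, hpos⟩}, ?_, ?_⟩
      · intro y hy
        refine ⟨0, ?_, ?_⟩
        · rintro ⟨-, h⟩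
          apply h
          ext i
          fin_cases i <;> rfl
        · intro y' hy' hne
          exact absurd ((Finset.mem_singleton.1 hy').trans (Finset.mem_singleton.1 hy).symm) hne
      · simp only [Finset.card_singleton]
        interval_cases n <;> norm_num
  · have h1 : 1 ≤ Nat.sqrt (n / 3) := Nat.le_sqrt.2 (by omega)
    have h2 := Nat.sqrt_le' (n / 3)
    have h3 := Nat.lt_succ_sqrt' (n / 3)
    set m := Nat.sqrt (n / 3)
    obtain ⟨Y, hY, hc⟩ := exists_isNonRedundant_cube (m := m) (n := n) (by omega)
    refine ⟨Y, hY, ?_⟩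
    -- As m ≥ 1, n / 3 < (m + 1)² ≤ 4m². The constant 1728 is 12³, and 42² exceeds it below.
    have h4 : n ≤ 12 * m ^ 2 := by
      have : (m + 1) ^ 2 ≤ 4 * m ^ 2 := by nlinarith
      have h3' : n / 3 < (m + 1) ^ 2 := h3
      omega
    calc n ^ 3 ≤ (12 * m ^ 2) ^ 3 := Nat.pow_le_pow_left h4 3
      _ = 1728 * Y.card ^ 2 := by rw [hc]; ring

lemma exists_isNonRedundant_rpow (n : ℕ) :
    ∃ Y : Finset (Fin 3 → Fin n), IsNonRedundant (threeLinStar (ZMod 3)) Y ∧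
      1 / 42 * (n : ℝ) ^ (3 / 2 : ℝ) ≤ Y.card := by
  obtain ⟨Y, hY, h⟩ := exists_isNonRedundant_large n
  refine ⟨Y, hY, ?_⟩
  have h' : (n : ℝ) ^ 3 ≤ 1728 * (Y.card : ℝ) ^ 2 := by exact_mod_cast h
  have hn : (0 : ℝ) ≤ n := Nat.cast_nonneg n
  have hsq : ((n : ℝ) ^ (3 / 2 : ℝ)) ^ 2 = (n : ℝ) ^ 3 := by
    rw [← Real.rpow_natCast, ← Real.rpow_mul hn, ← Real.rpow_natCast]
    norm_num
  have : (n : ℝ) ^ (3 / 2 : ℝ) ≤ 42 * Y.card := by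
    refine abs_le_of_sq_le_sq' ?_ (by positivity) |>.2
    rw [hsq]
    nlinarith
  linarith

end LowerBound

/-! ### Matching families: rank bound and subspace extension. -/

section UpperBound

/-- The forms φ are dual to the vectors f up to nonzero scalars, so φ i isolates the i-th
coefficient of a linear relation. -/
lemma card_le_finrank_of_pairing {K E ι : Type*} [Field K] [AddCommGroup E] [Module K E]
    [FiniteDimensional K E] [Fintype ι] (f : ι → E) (φ : ι → E →ₗ[K] K)
    (h : ∀ i, φ i (f i) ≠ 0) (h' : ∀ i j, i ≠ j → φ i (f j) = 0) :
    Fintype.card ι ≤ Module.finrank K E := by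
  classical
  have hli : LinearIndependent K f := by
    rw [Fintype.linearIndependent_iff]
    intro g hg i
    have := congrArg (φ i) hg
    rw [map_sum, map_zero, Finset.sum_eq_single i] at this
    · simpa [h i] using this
    · intro j _ hj
      rw [map_smul, h' i j hj.symm, smul_zero]
    · simp
  exact hli.fintype_card_le_finrank

/-- A family of triples of vectors over `ZMod 3` with zero sum, indexed by the coordinates, such
that the `j`-th coordinate vanishes on the triple `i` exactly if `i = j`. -/
structure IsMatchingFamily {ι : Type*} (a : ι → Fin 3 → ι → ZMod 3) : Prop where
  sum_eq : ∀ i, a i 0 + a i 1 + a i 2 = 0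
  diag : ∀ i p, a i p i = 0
  off_diag : ∀ i j, j ≠ i → ∃ p, a i p j ≠ 0

namespace IsMatchingFamily

variable {ι : Type*} {a : ι → Fin 3 → ι → ZMod 3}

lemma injective (ha : IsMatchingFamily a) : Function.Injective a := by
  intro i j hij
  by_contra hne
  obtain ⟨p, hp⟩ := ha.off_diag i j (Ne.symm hne)
  exact hp (by rw [hij]; exact ha.diag j p)

lemma eq_of_zero (ha : IsMatchingFamily a) {i j : ι} (h0 : a i 0 j = 0) (h1 : a i 1 j = 0) :
    j = i := by
  by_contra hne
  obtain ⟨p, hp⟩ := ha.off_diag i j hne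
  have h2 : a i 2 j = 0 := by
    have := congrFun (ha.sum_eq i) j
    simpa [h0, h1] using this
  fin_cases p
  · exact hp h0
  · exact hp h1
  · exact hp h2

/-- Cyclic indices p, p + 1, p + 2 in `Fin 3` single out one vector of a triple without fixing
which. -/
lemma sum_rotate (ha : IsMatchingFamily a) (i : ι) (p : Fin 3) :
    a i p = -(a i (p + 1) + a i (p + 2)) := by
  have h := ha.sum_eq i
  fin_cases p <;> simp only [Fin.mk_one, Fin.zero_eta, Fin.reduceFinMk, zero_add, Fin.reduceAdd]
  · exact eq_neg_of_add_eq_zero_left (by rw [← add_assoc]; exact h)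
  · exact eq_neg_of_add_eq_zero_left (by rw [← h]; abel)
  · exact eq_neg_of_add_eq_zero_left (by rw [← h]; abel)

lemma ext_of_pair (ha : IsMatchingFamily a) {i j : ι} {p : Fin 3}
    (h1 : a i (p + 1) = a j (p + 1)) (h2 : a i (p + 2) = a j (p + 2)) : i = j := by
  apply ha.injective
  have h0 : a i p = a j p := by rw [ha.sum_rotate i p, ha.sum_rotate j p, h1, h2]
  ext1 q
  fin_cases p <;> fin_cases q <;> simp_all

/-- The rank bound: triples inside a subspace of dimension `R` are at most `(1 + R ^ 2) ^ 2`. -/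
lemma card_le_of_mem (ha : IsMatchingFamily a) [Finite ι] (H : Submodule (ZMod 3) (ι → ZMod 3))
    (s : Finset ι) (hs : ∀ i ∈ s, ∀ p, a i p ∈ H) :
    s.card ≤ (1 + Module.finrank (ZMod 3) H ^ 2) ^ 2 := by
  classical
  set R := Module.finrank (ZMod 3) H
  let b := Module.finBasis (ZMod 3) H
  -- Over `ZMod 3` the function 1 - x² is the indicator of 0. For v in H it is a combination of the
  -- constant 1 and the R² products of two basis vectors.
  let Q : Option (Fin R × Fin R) → s → ZMod 3 := fun q j =>
    q.elim 1 fun rs => (b rs.1 : ι → ZMod 3) j * (b rs.2 : ι → ZMod 3) j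
  have hQ : ∀ v ∈ H, ∃ c : Option (Fin R × Fin R) → ZMod 3, ∀ j : s,
      1 - v j ^ 2 = ∑ q, c q * Q q j := by
    intro v hv
    let d := b.repr ⟨v, hv⟩
    have hvd : ∀ j, v j = ∑ r, d r * (b r : ι → ZMod 3) j := by
      intro j
      have h1 := congrArg (fun x : H => (x : ι → ZMod 3) j) (b.sum_repr ⟨v, hv⟩)
      simp only [Submodule.coe_sum, Submodule.coe_smul, Finset.sum_apply, Pi.smul_apply,
        smul_eq_mul] at h1
      exact h1.symm
    refine ⟨fun q => q.elim 1 fun rs => -(d rs.1 * d rs.2), fun j => ?_⟩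
    rw [Fintype.sum_option, Fintype.sum_prod_type, hvd, sq, Finset.sum_mul_sum]
    simp only [Q, Option.elim, mul_one, sub_eq_add_neg, ← Finset.sum_neg_distrib]
    congr 1
    refine Finset.sum_congr rfl fun r _ => Finset.sum_congr rfl fun r' _ => ?_
    ring
  let G : Option (Fin R × Fin R) × Option (Fin R × Fin R) → s → ZMod 3 := fun q =>
    Q q.1 * Q q.2
  -- The product of the indicators for a i 0 and a i 1 is the indicator of coordinate i: two zeros
  -- force the third, hence j = i. So the products of two functions `Q` span everything.
  have hspan : Submodule.span (ZMod 3) (Set.range G) = ⊤ := by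
    rw [eq_top_iff, ← (Pi.basisFun (ZMod 3) s).span_eq, Submodule.span_le]
    rintro _ ⟨i, rfl⟩
    obtain ⟨c0, hc0⟩ := hQ _ (hs i i.2 0)
    obtain ⟨c1, hc1⟩ := hQ _ (hs i i.2 1)
    have : (Pi.basisFun (ZMod 3) s) i = ∑ q, (c0 q.1 * c1 q.2) • G q := by
      ext j
      rw [Finset.sum_apply, Fintype.sum_prod_type]
      have e1 : (1 - a i 0 j ^ 2) * (1 - a i 1 j ^ 2) = ∑ q, ∑ q', (c0 q * c1 q') •
          (Q q j * Q q' j) := by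
        rw [hc0 j, hc1 j, Finset.sum_mul_sum]
        refine Finset.sum_congr rfl fun q _ => Finset.sum_congr rfl fun q' _ => ?_
        rw [smul_eq_mul]
        ring
      simp only [Pi.smul_apply, G, Pi.mul_apply]
      rw [← e1, Pi.basisFun_apply]
      by_cases hij : j = i
      · subst hij
        simp [ha.diag]
      · rw [Pi.single_eq_of_ne hij]
        have hz : a i 0 j ≠ 0 ∨ a i 1 j ≠ 0 := by
          by_contra hcon
          push Not at hcon
          exact hij (Subtype.ext (ha.eq_of_zero hcon.1 hcon.2))
        have hsq : ∀ x : ZMod 3, x ≠ 0 → 1 - x ^ 2 = 0 := by decide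
        rcases hz with hz | hz
        · rw [hsq _ hz, zero_mul]
        · rw [hsq _ hz, mul_zero]
    rw [this]
    exact Submodule.sum_mem _ fun q _ => Submodule.smul_mem _ _
      (Submodule.subset_span (Set.mem_range_self q))
  have h1 : Module.finrank (ZMod 3) (s → ZMod 3) ≤ Fintype.card
      (Option (Fin R × Fin R) × Option (Fin R × Fin R)) := by
    rw [← finrank_top, ← hspan]
    exact finrank_range_le_card G
  simp only [Module.finrank_fintype_fun_eq_card, Fintype.card_coe, Fintype.card_prod,
    Fintype.card_option, Fintype.card_fin] at h1
  calc s.card ≤ (R * R + 1) * (R * R + 1) := h1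
    _ = _ := by ring

variable [Fintype ι]

open Classical in
/-- The triples of the family with all entries in `T`. -/
noncomputable def inside (a : ι → Fin 3 → ι → ZMod 3) (T : Finset (ι → ZMod 3)) : Finset ι :=
  Finset.univ.filter fun i => ∀ p, a i p ∈ T

lemma mem_inside {T : Finset (ι → ZMod 3)} {i : ι} : i ∈ inside a T ↔ ∀ p, a i p ∈ T := by
  classical
  simp [inside]

lemma card_inside_le (ha : IsMatchingFamily a) (T : Finset (ι → ZMod 3)) :
    (inside a T).card ≤ T.card ^ 2 := by
  classical
  rw [sq, ← Finset.card_product]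
  refine Finset.card_le_card_of_injOn (fun i => (a i 0, a i 1)) ?_ ?_
  · intro i hi
    have := mem_inside.1 hi
    exact Finset.mem_coe.2 (Finset.mem_product.2 ⟨this 0, this 1⟩)
  · intro i _ j _ hij
    simp only [Prod.mk.injEq] at hij
    exact ha.ext_of_pair (p := 2) hij.1 hij.2

open Classical in
/-- Either the trace of a subspace on `T` contains many triples, or some vector of `T` enlarges
this trace a lot. -/
lemma exists_extension (ha : IsMatchingFamily a) (T : Finset (ι → ZMod 3))
    (H : Submodule (ZMod 3) (ι → ZMod 3)) :
    ∃ H' : Submodule (ZMod 3) (ι → ZMod 3),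
      Module.finrank (ZMod 3) H' ≤ Module.finrank (ZMod 3) H + 1 ∧
      (inside a T).card ≤ (inside a (T.filter (· ∈ H))).card +
        (inside a (T.filter (· ∉ H))).card +
        3 * T.card * ((T.filter (· ∈ H')).card - (T.filter (· ∈ H)).card) := by
  set W := T.filter (· ∈ H)
  set U := T.filter (· ∉ H)
  -- The possible partners of u all lie in the coset -u + H, so adjoining u to H captures them
  -- together; u is chosen with the most partners.
  let cls : (ι → ZMod 3) → Finset (ι → ZMod 3) := fun u => U.filter fun k => u + k ∈ H
  obtain ⟨u, hu⟩ : ∃ u, ∀ u' ∈ U, (cls u').card ≤ (cls u).card := by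
    rcases U.eq_empty_or_nonempty with h | h
    · exact ⟨0, by simp [h]⟩
    · obtain ⟨u, -, hu⟩ := U.exists_max_image (fun u => (cls u).card) h
      exact ⟨u, hu⟩
  refine ⟨H ⊔ Submodule.span (ZMod 3) {u}, ?_, ?_⟩
  · refine (Submodule.finrank_add_le_finrank_add_finrank _ _).trans ?_
    have := finrank_span_le_card (R := ZMod 3) ({u} : Set (ι → ZMod 3))
    simp only [Set.toFinset_singleton, Finset.card_singleton] at this
    omega
  · have hsub : W ∪ cls u ⊆ T.filter (· ∈ H ⊔ Submodule.span (ZMod 3) {u}) := by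
      intro k hk
      rcases Finset.mem_union.1 hk with hk | hk
      · obtain ⟨h1, h2⟩ := Finset.mem_filter.1 hk
        exact Finset.mem_filter.2 ⟨h1, Submodule.mem_sup_left h2⟩
      · obtain ⟨h1, h2⟩ := Finset.mem_filter.1 hk
        refine Finset.mem_filter.2 ⟨(Finset.mem_filter.1 h1).1, ?_⟩
        have : k = (u + k) - u := by abel
        rw [this]
        exact Submodule.sub_mem _ (Submodule.mem_sup_left h2)
          (Submodule.mem_sup_right (Submodule.mem_span_singleton_self u))
    have hdisj : Disjoint W (cls u) := by
      rw [Finset.disjoint_left]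
      intro k hk hk'
      exact (Finset.mem_filter.1 (Finset.mem_filter.1 hk').1).2 (Finset.mem_filter.1 hk).2
    have hcard := Finset.card_le_card hsub
    rw [Finset.card_union_of_disjoint hdisj] at hcard
    -- Two vectors of a triple in H put the third there, so the remaining triples have exactly one
    -- vector in H. The other two are partners, and with the position p they determine the triple.
    set M : Finset ι := (inside a T \ inside a W) \ inside a U with hM
    have hMle : M.card ≤ 3 * T.card * (cls u).card := by
      have hpos : ∀ i ∈ M, ∃ p, a i p ∈ H ∧ a i (p + 1) ∈ U ∧ a i (p + 2) ∈ U := by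
        intro i hi
        simp only [hM, Finset.mem_sdiff, mem_inside, not_forall] at hi
        obtain ⟨⟨hT, hW⟩, p, hp⟩ := hi
        have hpH : a i p ∈ H := by
          by_contra hcon
          exact hp (Finset.mem_filter.2 ⟨hT p, hcon⟩)
        have hn : ∀ q r : Fin 3, a i p = -(a i q + a i r) → a i q ∈ H →
            a i r ∈ H := by
          intro q r hs hq
          have : a i r = - a i p - a i q := by rw [hs]; abel
          rw [this]
          exact H.sub_mem (H.neg_mem hpH) hq
        have h12 := ha.sum_rotate i p
        have h21 : a i p = -(a i (p + 2) + a i (p + 1)) := by rw [h12, add_comm]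
        have hall : ¬ (a i (p + 1) ∈ H ∧ a i (p + 2) ∈ H) := by
          rintro ⟨g1, g2⟩
          obtain ⟨q, hq⟩ := hW
          apply hq
          refine Finset.mem_filter.2 ⟨hT q, ?_⟩
          have hq3 : ∀ p q : Fin 3, q = p ∨ q = p + 1 ∨ q = p + 2 := by decide
          rcases hq3 p q with rfl | rfl | rfl <;> assumption
        refine ⟨p, hpH, Finset.mem_filter.2 ⟨hT _, fun g => hall ⟨g, hn _ _ h12 g⟩⟩,
          Finset.mem_filter.2 ⟨hT _, fun g => hall ⟨hn _ _ h21 g, g⟩⟩⟩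
      choose! p hpH hp1 hp2 using hpos
      have hle : M.card ≤ ((Finset.univ : Finset (Fin 3)) ×ˢ (U.sigma cls)).card := by
        refine Finset.card_le_card_of_injOn
          (fun i => (p i, ⟨a i (p i + 1), a i (p i + 2)⟩)) ?_ ?_
        · intro i hi
          have hi' : i ∈ M := hi
          refine Finset.mem_coe.2 (Finset.mem_product.2 ⟨Finset.mem_univ _,
            Finset.mem_sigma.2 ⟨hp1 i hi', Finset.mem_filter.2 ⟨hp2 i hi', ?_⟩⟩⟩)
          have := ha.sum_rotate i (p i)
          have h3 : a i (p i + 1) + a i (p i + 2) = - a i (p i) := by rw [this]; abel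
          simp only [h3]
          exact H.neg_mem (hpH i hi')
        · intro i _ j _ hij
          simp only [Prod.mk.injEq, Sigma.mk.injEq, heq_eq_eq] at hij
          obtain ⟨g0, g1, g2⟩ := hij
          rw [← g0] at g1 g2
          exact ha.ext_of_pair g1 g2
      rw [Finset.card_product, Finset.card_sigma, Finset.card_univ, Fintype.card_fin] at hle
      have h2 : ∑ u' ∈ U, (cls u').card ≤ T.card * (cls u).card := by
        calc ∑ u' ∈ U, (cls u').card ≤ ∑ _u' ∈ U, (cls u).card := Finset.sum_le_sum hu
          _ = U.card * (cls u).card := by simp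
          _ ≤ T.card * (cls u).card :=
            Nat.mul_le_mul_right _ (Finset.card_le_card (Finset.filter_subset _ _))
      nlinarith
    have hsplit : (inside a T).card ≤ (inside a W).card + (inside a U).card + M.card := by
      have : inside a T ⊆ (inside a W ∪ inside a U) ∪ M := by
        intro i hi
        simp only [hM, Finset.mem_union, Finset.mem_sdiff]
        tauto
      exact (Finset.card_le_card this).trans ((Finset.card_union_le _ _).trans
        (Nat.add_le_add_right (Finset.card_union_le _ _) _))
    have h3 : (cls u).card ≤ (T.filter (· ∈ H ⊔ Submodule.span (ZMod 3) {u})).card - W.card := by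
      omega
    calc _ ≤ _ := hsplit
      _ ≤ _ := Nat.add_le_add_left (hMle.trans (Nat.mul_le_mul_left _ h3)) _

end IsMatchingFamily

end UpperBound

/-! ### The densest set and the exponent 8/5. -/

namespace IsMatchingFamily

variable {ι : Type*} {a : ι → Fin 3 → ι → ZMod 3} [Fintype ι]

lemma inside_empty : inside a ∅ = ∅ := by
  ext i
  simp [mem_inside]

open Classical in
/-- In a set `T` of maximal density for the exponent `8 / 5`, a subspace of small dimension contains
a constant fraction of the triples. -/
lemma exists_dense_subspace (ha : IsMatchingFamily a) (T : Finset (ι → ZMod 3))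
    (hT : T.Nonempty) (he : 0 < (inside a T).card)
    (hmax : ∀ S ⊆ T, ((inside a S).card : ℝ) ≤
      (inside a T).card * ((S.card : ℝ) / T.card) ^ (8 / 5 : ℝ)) :
    ∃ H : Submodule (ZMod 3) (ι → ZMod 3),
      ((inside a T).card : ℝ) ≤ 8 * (inside a (T.filter (· ∈ H))).card ∧
      (Module.finrank (ZMod 3) H : ℝ) ≤
        14 * ((T.card : ℝ) ^ 2 / (inside a T).card) * (1 + Real.log T.card) := by
  set t : ℝ := (T.card : ℝ) with ht
  set E : ℝ := ((inside a T).card : ℝ) with hE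
  have ht1 : 1 ≤ t := Nat.one_le_cast.2 hT.card_pos
  have ht0 : 0 < t := by linarith
  have hE0 : 0 < E := Nat.cast_pos.2 he
  have hEt : E ≤ t ^ 2 := by
    rw [hE, ht]
    exact_mod_cast ha.card_inside_le T
  -- The growth rate of the trace: a surplus of E|W|/(2t) triples is divided by the factor 3t of
  -- `exists_extension`.
  set x : ℝ := E / (6 * t ^ 2) with hx
  have hx0 : 0 < x := by positivity
  have hx1 : x ≤ 1 := by
    rw [hx, div_le_one (by positivity)]
    nlinarith
  -- Either some trace W already holds half of its proportional share E|W|/t of triples, or the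
  -- trace has grown geometrically for s steps.
  have step : ∀ s : ℕ, (∃ H : Submodule (ZMod 3) (ι → ZMod 3),
      Module.finrank (ZMod 3) H ≤ s + 1 ∧ 0 < (T.filter (· ∈ H)).card ∧
      E / t * (T.filter (· ∈ H)).card ≤ 2 * (inside a (T.filter (· ∈ H))).card) ∨
      ∃ H : Submodule (ZMod 3) (ι → ZMod 3), Module.finrank (ZMod 3) H ≤ s + 1 ∧
        (1 + x) ^ s ≤ (T.filter (· ∈ H)).card := by
    intro s
    induction s with
    | zero =>
      right
      obtain ⟨v, hv⟩ := hT
      refine ⟨Submodule.span (ZMod 3) {v}, ?_, ?_⟩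
      · have := finrank_span_le_card (R := ZMod 3) ({v} : Set (ι → ZMod 3))
        simpa using this
      · have : 0 < (T.filter (· ∈ Submodule.span (ZMod 3) {v})).card :=
          Finset.card_pos.2 ⟨v, Finset.mem_filter.2 ⟨hv, Submodule.mem_span_singleton_self v⟩⟩
        rw [pow_zero]
        exact_mod_cast this
    | succ s ih =>
      rcases ih with ⟨H, h1, h2⟩ | ⟨H, h1, h2⟩
      · exact Or.inl ⟨H, by omega, h2⟩
      · set W := T.filter (· ∈ H) with hW
        have hWpos : (0 : ℝ) < W.card := lt_of_lt_of_le (by positivity) h2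
        by_cases hd : E / t * W.card ≤ 2 * (inside a W).card
        · exact Or.inl ⟨H, by omega, by exact_mod_cast hWpos, hd⟩
        · right
          push Not at hd
          obtain ⟨H', g1, g2⟩ := ha.exists_extension T H
          refine ⟨H', by omega, ?_⟩
          have hWT : (W.card : ℝ) ≤ t :=
            Nat.cast_le.2 (Finset.card_le_card (Finset.filter_subset _ _))
          have hU : ((T.filter (· ∉ H)).card : ℝ) = t - W.card := by
            have := Finset.card_filter_add_card_filter_not (s := T) (· ∈ H)
            rw [ht, ← this]
            push_cast
            ring
          -- As 8/5 ≥ 1, maximality leaves at most the proportional share of triples outside H, so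
          -- those meeting H number at least E|W|/t.
          have hUe : ((inside a (T.filter (· ∉ H))).card : ℝ) ≤ E - E / t * W.card := by
            refine (hmax _ (Finset.filter_subset _ _)).trans ?_
            rw [hU]
            have h01 : 0 ≤ (t - W.card) / t := div_nonneg (by linarith) ht0.le
            have h02 : (t - W.card) / t ≤ 1 := by
              rw [div_le_one ht0]
              linarith
            have := Real.rpow_le_rpow_of_exponent_ge' h01 h02 (z := 1) (y := 8 / 5)
              (by norm_num) (by norm_num)
            rw [Real.rpow_one] at this
            calc E * ((t - W.card) / t) ^ (8 / 5 : ℝ) ≤ E * ((t - W.card) / t) := by gcongr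
              _ = _ := by field_simp
          have hgrow : E / t * W.card / 2 ≤
              3 * t * (((T.filter (· ∈ H')).card : ℝ) - W.card) := by
            have g2' : E ≤ (inside a W).card + (inside a (T.filter (· ∉ H))).card +
                3 * t * (((T.filter (· ∈ H')).card - W.card : ℕ) : ℝ) := by
              rw [hE, ht]
              exact_mod_cast g2
            rcases le_or_gt W.card (T.filter (· ∈ H')).card with hle | hgt
            · rw [Nat.cast_sub hle] at g2'
              linarith
            · rw [Nat.sub_eq_zero_of_le hgt.le] at g2'
              exfalso
              have : 0 < E / t * W.card := by positivity
              push_cast at g2'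
              linarith
          have hgrow' : x * W.card ≤ ((T.filter (· ∈ H')).card : ℝ) - W.card := by
            have e : E / t * W.card / 2 = 3 * t * (x * W.card) := by
              rw [hx]
              field_simp
              norm_num
            rw [e] at hgrow
            exact le_of_mul_le_mul_left hgrow (by positivity)
          calc (1 + x) ^ (s + 1) = (1 + x) ^ s * (1 + x) := pow_succ _ _
            _ ≤ W.card * (1 + x) := by gcongr
            _ ≤ _ := by linarith
  obtain ⟨H, hR, hpos, hd⟩ : ∃ H : Submodule (ZMod 3) (ι → ZMod 3),
      Module.finrank (ZMod 3) H ≤ ⌊2 / x * Real.log t⌋₊ + 2 ∧ 0 < (T.filter (· ∈ H)).card ∧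
      E / t * (T.filter (· ∈ H)).card ≤ 2 * (inside a (T.filter (· ∈ H))).card := by
    -- Since log(1 + x) ≥ x/2, growth for this many steps would make the trace larger than T.
    rcases step (⌊2 / x * Real.log t⌋₊ + 1) with h | ⟨H, -, h⟩
    · exact h
    · exfalso
      have hle : (1 + x) ^ (⌊2 / x * Real.log t⌋₊ + 1) ≤ t :=
        h.trans (Nat.cast_le.2 (Finset.card_le_card (Finset.filter_subset _ _)))
      have h1 := Real.log_le_log (by positivity) hle
      rw [Real.log_pow] at h1
      have h2 : 2 / x * Real.log t < ((⌊2 / x * Real.log t⌋₊ + 1 : ℕ) : ℝ) := by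
        push_cast
        exact Nat.lt_floor_add_one _
      have h3 : x / 2 ≤ Real.log (1 + x) := by
        have := Real.one_sub_inv_le_log_of_pos (x := 1 + x) (by positivity)
        refine le_trans ?_ this
        rw [← one_div, div_le_iff₀ (by norm_num), sub_mul, ← sub_nonneg]
        have : (1 / (1 + x)) ≤ 1 - x / 2 := by
          rw [div_le_iff₀ (by positivity)]
          nlinarith
        linarith
      have h4 : Real.log t < ((⌊2 / x * Real.log t⌋₊ + 1 : ℕ) : ℝ) * (x / 2) := by
        have := mul_lt_mul_of_pos_right h2 (show 0 < x / 2 by positivity)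
        refine lt_of_eq_of_lt ?_ this
        field_simp
      have h5 : ((⌊2 / x * Real.log t⌋₊ + 1 : ℕ) : ℝ) * (x / 2) ≤
        ((⌊2 / x * Real.log t⌋₊ + 1 : ℕ) : ℝ) * Real.log (1 + x) := by gcongr
      linarith
  refine ⟨H, ?_, ?_⟩
  · set W := T.filter (· ∈ H)
    set μ : ℝ := (W.card : ℝ) / t with hμ
    have hμ0 : 0 < μ := div_pos (by exact_mod_cast hpos) ht0
    have e1 : E / t * W.card = E * μ := by rw [hμ]; ring
    rw [e1] at hd
    have h1 := hmax W (Finset.filter_subset _ _)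
    -- Density gives Eμ/2 triples in W at least, maximality Eμ^{8/5} at most, so μ^{3/5} ≥ 1/2. This
    -- fails for μ < 1/4, as then μ^{3/5} < (1/4)^{1/2}.
    have h2 : 1 / 4 ≤ μ := by
      by_contra hcon
      push Not at hcon
      have h3 : μ ^ (8 / 5 : ℝ) < μ / 2 := by
        have e2 : μ ^ (8 / 5 : ℝ) = μ ^ (3 / 5 : ℝ) * μ := by
          nth_rewrite 3 [← Real.rpow_one μ]
          rw [← Real.rpow_add hμ0]
          norm_num
        have h4 : μ ^ (3 / 5 : ℝ) < (1 / 4 : ℝ) ^ (1 / 2 : ℝ) := by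
          calc μ ^ (3 / 5 : ℝ) < (1 / 4 : ℝ) ^ (3 / 5 : ℝ) :=
                Real.rpow_lt_rpow hμ0.le hcon (by norm_num)
            _ ≤ _ := Real.rpow_le_rpow_of_exponent_ge (by norm_num) (by norm_num) (by norm_num)
        have h5 : (1 / 4 : ℝ) ^ (1 / 2 : ℝ) = 1 / 2 := by
          rw [← Real.sqrt_eq_rpow, show (1 / 4 : ℝ) = (1 / 2) ^ 2 by norm_num]
          exact Real.sqrt_sq (by norm_num)
        rw [e2]
        rw [h5] at h4
        nlinarith
      have h6 : E * μ ^ (8 / 5 : ℝ) < E * (μ / 2) := by gcongr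
      have h7 : (2 : ℝ) * (inside a W).card ≤ 2 * (E * μ ^ (8 / 5 : ℝ)) := by gcongr
      linarith
    have h3 : E * (1 / 4) ≤ E * μ := by gcongr
    linarith
  · have hlog : 0 ≤ Real.log t := Real.log_nonneg ht1
    have h1 : (Module.finrank (ZMod 3) H : ℝ) ≤ 2 / x * Real.log t + 2 := by
      have h2 : (Module.finrank (ZMod 3) H : ℝ) ≤ (⌊2 / x * Real.log t⌋₊ : ℝ) + 2 := by
        exact_mod_cast hR
      have := Nat.floor_le (show 0 ≤ 2 / x * Real.log t by positivity)
      linarith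
    have h2 : 2 / x = 12 * (t ^ 2 / E) := by
      rw [hx]
      field_simp
      norm_num
    have h3 : 1 ≤ t ^ 2 / E := by
      rw [le_div_iff₀ hE0]
      linarith
    rw [h2] at h1
    nlinarith [mul_nonneg (by linarith : (0 : ℝ) ≤ t ^ 2 / E) hlog]

-- Taking T to maximise triples over |T|^{8/5} among nonempty subsets of V reduces the bound to T,
-- where the dense subspace meets the rank bound.
open Classical in
lemma card_le (ha : IsMatchingFamily a) (V : Finset (ι → ZMod 3))
    (hV : ∀ i p, a i p ∈ V) :
    (Fintype.card ι : ℝ) ≤ 17 * (1 + Real.log V.card) * (V.card : ℝ) ^ (8 / 5 : ℝ) := by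
  rcases isEmpty_or_nonempty ι with hι | ⟨⟨i0⟩⟩
  · simp only [Fintype.card_eq_zero, Nat.cast_zero]
    have : 0 ≤ Real.log V.card := Real.log_natCast_nonneg _
    positivity
  have hVne : V.Nonempty := ⟨_, hV i0 0⟩
  have hins : inside a V = Finset.univ := by
    ext i
    simp [mem_inside, hV]
  let F : Finset (ι → ZMod 3) → ℝ := fun S => (inside a S).card / (S.card : ℝ) ^ (8 / 5 : ℝ)
  obtain ⟨T, hTm, hTmax⟩ := (V.powerset.filter Finset.Nonempty).exists_max_image F
    ⟨V, Finset.mem_filter.2 ⟨Finset.mem_powerset_self V, hVne⟩⟩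
  obtain ⟨hTV, hT⟩ := Finset.mem_filter.1 hTm
  rw [Finset.mem_powerset] at hTV
  have hVF := hTmax V (Finset.mem_filter.2 ⟨Finset.mem_powerset_self V, hVne⟩)
  have hv1 : (1 : ℝ) ≤ V.card := by exact_mod_cast hVne.card_pos
  have ht1 : (1 : ℝ) ≤ T.card := by exact_mod_cast hT.card_pos
  have htv : (T.card : ℝ) ≤ V.card := by exact_mod_cast Finset.card_le_card hTV
  have hcpos : 0 < Fintype.card ι := Fintype.card_pos_iff.2 ⟨i0⟩
  have hFV : F V = (Fintype.card ι : ℝ) / (V.card : ℝ) ^ (8 / 5 : ℝ) := by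
    simp only [F, hins, Finset.card_univ]
  have hFVpos : 0 < F V := by
    rw [hFV]
    have : (0 : ℝ) < Fintype.card ι := by exact_mod_cast hcpos
    positivity
  set t : ℝ := (T.card : ℝ) with ht
  set E : ℝ := ((inside a T).card : ℝ) with hE
  have hFT : F T = E / t ^ (8 / 5 : ℝ) := rfl
  have ht0 : 0 < t := by linarith
  have hE0 : 0 < E := by
    have h1 := hFVpos.trans_le hVF
    rw [hFT] at h1
    by_contra hcon
    have : E / t ^ (8 / 5 : ℝ) ≤ 0 := div_nonpos_of_nonpos_of_nonneg (not_lt.1 hcon) (by positivity)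
    linarith
  obtain ⟨H, h8, hR⟩ := ha.exists_dense_subspace T hT (Nat.cast_pos.1 hE0) (by
    intro S hS
    rcases S.eq_empty_or_nonempty with rfl | hSne
    · rw [inside_empty]
      simp
    · have h1 := hTmax S (Finset.mem_filter.2 ⟨Finset.mem_powerset.2 (hS.trans hTV), hSne⟩)
      have hs0 : (0 : ℝ) < S.card := by exact_mod_cast hSne.card_pos
      rw [hFT, div_le_iff₀ (by positivity)] at h1
      refine h1.trans (le_of_eq ?_)
      rw [Real.div_rpow hs0.le ht0.le]
      ring)
  have hrank := ha.card_le_of_mem H (inside a (T.filter (· ∈ H))) (fun i hi p =>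
    (Finset.mem_filter.1 (mem_inside.1 hi p)).2)
  set L : ℝ := 1 + Real.log V.card with hL
  have hL1 : 1 ≤ L := by
    have := Real.log_nonneg hv1
    linarith
  have hlogle : 1 + Real.log t ≤ L := by
    have := Real.log_le_log ht0 htv
    linarith
  have hEt : E ≤ t ^ 2 := by
    rw [hE, ht]
    exact_mod_cast ha.card_inside_le T
  set q : ℝ := t ^ 2 / E with hq
  have hq1 : 1 ≤ q := by
    rw [hq, le_div_iff₀ hE0]
    linarith
  have hR' : (Module.finrank (ZMod 3) H : ℝ) ≤ 14 * q * L := hR.trans (by gcongr)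
  have hqL : 1 ≤ 14 * q * L := by nlinarith
  have hmain : E ≤ 32 * (14 * q * L) ^ 4 := by
    have h1 : ((inside a (T.filter (· ∈ H))).card : ℝ) ≤
        (1 + (Module.finrank (ZMod 3) H : ℝ) ^ 2) ^ 2 := by exact_mod_cast hrank
    have h2 : (1 + (Module.finrank (ZMod 3) H : ℝ) ^ 2) ^ 2 ≤ (2 * (14 * q * L) ^ 2) ^ 2 := by
      have h3 : (Module.finrank (ZMod 3) H : ℝ) ^ 2 ≤ (14 * q * L) ^ 2 := by gcongr
      have h4 : 1 ≤ (14 * q * L) ^ 2 := one_le_pow₀ hqL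
      gcongr
      linarith
    calc E ≤ 8 * (2 * (14 * q * L) ^ 2) ^ 2 := by linarith
      _ = _ := by ring
  -- Multiplying by q⁴, with q = t²/E, turns (E/t)⁵ into E t³, and q cancels against `hmain`. The
  -- constant 17 satisfies 32 · 14⁴ ≤ 17⁵.
  have h5 : (E / t) ^ 5 ≤ (17 * L * t ^ (3 / 5 : ℝ)) ^ 5 := by
    have e1 : (t ^ (3 / 5 : ℝ)) ^ 5 = t ^ 3 := by
      rw [← Real.rpow_natCast, ← Real.rpow_mul ht0.le, ← Real.rpow_natCast]
      norm_num
    rw [mul_pow, e1]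
    have e2 : (E / t) ^ 5 * q ^ 4 = E * t ^ 3 := by
      rw [hq]
      field_simp
    have h6 : (E / t) ^ 5 * q ^ 4 ≤ (32 * 14 ^ 4 * L ^ 4 * t ^ 3) * q ^ 4 := by
      rw [e2]
      calc E * t ^ 3 ≤ 32 * (14 * q * L) ^ 4 * t ^ 3 := by gcongr
        _ = _ := by ring
    have h7 := le_of_mul_le_mul_right h6 (by positivity)
    refine h7.trans ?_
    have h8 : L ^ 4 ≤ L ^ 5 := pow_le_pow_right₀ hL1 (by norm_num)
    rw [mul_pow]
    gcongr
    norm_num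
  have h6 : E / t ≤ 17 * L * t ^ (3 / 5 : ℝ) := le_of_pow_le_pow_left₀ (by norm_num) (by positivity) h5
  have h7 : F T ≤ 17 * L := by
    rw [hFT, div_le_iff₀ (by positivity)]
    have e1 : t ^ (8 / 5 : ℝ) = t ^ (3 / 5 : ℝ) * t := by
      nth_rewrite 3 [← Real.rpow_one t]
      rw [← Real.rpow_add ht0]
      norm_num
    rw [e1]
    rw [div_le_iff₀ ht0] at h6
    linarith
  have h8 := hVF.trans h7
  rw [hFV, div_le_iff₀ (by positivity)] at h8
  exact h8

end IsMatchingFamily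

/-! ### From non-redundant instances to matching families. -/

open Classical in
/-- A non-redundant instance of `3LIN*` over `ZMod 3` has at most `O(n ^ 1.6 log n)` clauses. -/
lemma IsNonRedundant.card_le {n : ℕ} (hn : 1 ≤ n) {Y : Finset (Fin 3 → Fin n)}
    (hY : IsNonRedundant (threeLinStar (ZMod 3)) Y) :
    (Y.card : ℝ) ≤ 18 * (1 + Real.log n) * (n : ℝ) ^ (8 / 5 : ℝ) := by
  choose! σ hσ hσ' using hY
  let bad : (Fin 3 → Fin n) → Prop := fun y => σ y (y 0) + σ y (y 1) + σ y (y 2) ≠ 0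
  have hsum : ∀ y ∈ Y, ∀ y' ∈ Y, y' ≠ y → σ y (y' 0) + σ y (y' 1) + σ y (y' 2) = 0 :=
    fun y hy y' hy' hne => (hσ' y hy y' hy' hne).1
  -- The witnesses of bad clauses, as vectors indexed by the variables, are dual to the linear forms
  -- of those clauses.
  have h1 : (Y.filter bad).card ≤ n := by
    have := card_le_finrank_of_pairing (K := ZMod 3) (E := Fin n → ZMod 3)
      (ι := Y.filter bad) (fun y => σ y)
      (fun y => LinearMap.proj (R := ZMod 3) (φ := fun _ => ZMod 3) ((y : Fin 3 → Fin n) 0) +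
        LinearMap.proj ((y : Fin 3 → Fin n) 1) + LinearMap.proj ((y : Fin 3 → Fin n) 2))
      (fun y => (Finset.mem_filter.1 y.2).2)
      (fun y y' hne => hsum _ (Finset.mem_filter.1 y'.2).1 _ (Finset.mem_filter.1 y.2).1
        fun e => hne (Subtype.ext e))
    rwa [Fintype.card_coe, Module.finrank_fin_fun] at this
  set Z := Y.filter fun y => ¬ bad y with hZ
  have hZY : ∀ z : Z, (z : Fin 3 → Fin n) ∈ Y := fun z => (Finset.mem_filter.1 z.2).1
  have hZz : ∀ z : Z, σ z ((z : Fin 3 → Fin n) 0) + σ z ((z : Fin 3 → Fin n) 1) +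
      σ z ((z : Fin 3 → Fin n) 2) = 0 := fun z => not_not.1 (Finset.mem_filter.1 z.2).2
  have hdiag : ∀ (z : Z) (p : Fin 3), σ z ((z : Fin 3 → Fin n) p) = 0 := by
    intro z p
    have h2 := hσ z (hZY z)
    have h3 : σ z ∘ (z : Fin 3 → Fin n) = ![0, 0, 0] := by
      by_contra hne
      exact h2 ⟨hZz z, hne⟩
    have h4 := congrFun h3 p
    rw [Function.comp_apply] at h4
    rw [h4]
    fin_cases p <;> rfl
  -- Clause z becomes the triple of value vectors of its three variables, with the witnesses as
  -- coordinates; at most n distinct vectors occur.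
  let a : Z → Fin 3 → Z → ZMod 3 := fun z p z' => σ z' ((z : Fin 3 → Fin n) p)
  have ha : IsMatchingFamily a := by
    refine ⟨?_, hdiag, ?_⟩
    · intro z
      ext z'
      by_cases hne : z = z'
      · subst hne
        exact hZz z
      · exact hsum _ (hZY z') _ (hZY z) fun e => hne (Subtype.ext e)
    · intro z z' hne
      by_contra hcon
      push Not at hcon
      have h2 := hσ' z' (hZY z') z (hZY z) fun e => hne (Subtype.ext e.symm)
      apply h2.2
      ext p
      have := hcon p
      simp only [a] at this
      rw [Function.comp_apply, this]
      fin_cases p <;> rfl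
  let V : Finset (Z → ZMod 3) := Finset.univ.image fun (x : Fin n) z => σ z x
  have hVn : V.card ≤ n := Finset.card_image_le.trans (by simp)
  have hcard := ha.card_le V fun i p => Finset.mem_image_of_mem (fun x (z : Z) => σ z x)
    (Finset.mem_univ _)
  rw [Fintype.card_coe] at hcard
  have hn1 : (1 : ℝ) ≤ n := by exact_mod_cast hn
  have hlogn : 0 ≤ Real.log n := Real.log_nonneg hn1
  have h2 : (Z.card : ℝ) ≤ 17 * (1 + Real.log n) * (n : ℝ) ^ (8 / 5 : ℝ) := by
    refine hcard.trans ?_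
    have hVn' : (V.card : ℝ) ≤ n := by exact_mod_cast hVn
    have h3 : Real.log V.card ≤ Real.log n := by
      rcases Nat.eq_zero_or_pos V.card with h | h
      · rw [h]
        simpa using hlogn
      · exact Real.log_le_log (by exact_mod_cast h) hVn'
    have h4 : 0 ≤ Real.log V.card := Real.log_natCast_nonneg _
    gcongr
  have h3 : (Y.card : ℝ) = (Y.filter bad).card + Z.card := by
    rw [← Finset.card_filter_add_card_filter_not (s := Y) bad]
    push_cast
    rfl
  have h4 : ((Y.filter bad).card : ℝ) ≤ (1 + Real.log n) * (n : ℝ) ^ (8 / 5 : ℝ) := by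
    have h5 : (n : ℝ) ≤ (n : ℝ) ^ (8 / 5 : ℝ) := by
      nth_rewrite 1 [← Real.rpow_one (n : ℝ)]
      exact Real.rpow_le_rpow_of_exponent_le hn1 (by norm_num)
    calc ((Y.filter bad).card : ℝ) ≤ n := by exact_mod_cast h1
      _ ≤ 1 * (n : ℝ) ^ (8 / 5 : ℝ) := by linarith
      _ ≤ _ := by
        gcongr
        linarith
  rw [h3]
  linarith

lemma NRD_le {n : ℕ} (hn : 1 ≤ n) :
    (NRD (threeLinStar (ZMod 3)) n : ℝ) ≤ 18 * (1 + Real.log n) * (n : ℝ) ^ (8 / 5 : ℝ) := by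
  classical
  have h0 : (0 : ℝ) ≤ 18 * (1 + Real.log n) * (n : ℝ) ^ (8 / 5 : ℝ) := by
    have : 0 ≤ Real.log n := Real.log_natCast_nonneg _
    positivity
  refine (Nat.cast_le.2 (Finset.sup_le (a := ⌊18 * (1 + Real.log n) * (n : ℝ) ^ (8 / 5 : ℝ)⌋₊)
    fun Y hY => ?_)).trans (Nat.floor_le h0)
  exact Nat.le_floor (IsNonRedundant.card_le hn (Finset.mem_filter.1 hY).2)

/-! ### Counting small subsets. -/

section Counting

/-- A set with `m` elements has at most `(m + 1) ^ K` subsets of size at most `K`. -/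
lemma card_subsets_le {α : Type*} [Fintype α] [DecidableEq α] (K : ℕ) :
    ((Finset.univ : Finset (Finset α)).filter fun s => s.card ≤ K).card ≤
      (Fintype.card α + 1) ^ K := by
  classical
  -- A set of size at most K is listed in K slots, the spare ones filled with `none`.
  let g : (Fin K → Option α) → Finset α := fun h => Finset.univ.filter fun x => ∃ j, h j = some x
  have hsub : ((Finset.univ : Finset (Finset α)).filter fun s => s.card ≤ K) ⊆
      Finset.univ.image g := by
    intro s hs
    have hs' : s.card ≤ K := (Finset.mem_filter.1 hs).2
    let e := s.equivFin
    refine Finset.mem_image.2 ⟨fun j => if hj : j.val < s.card then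
      some (e.symm ⟨j.val, hj⟩ : α) else none, Finset.mem_univ _, ?_⟩
    ext x
    simp only [g, Finset.mem_filter, Finset.mem_univ, true_and]
    constructor
    · rintro ⟨j, hj⟩
      split_ifs at hj with h
      rw [← Option.some.inj hj]
      exact Subtype.prop _
    · intro hx
      refine ⟨⟨(e ⟨x, hx⟩).val, (e ⟨x, hx⟩).2.trans_le hs'⟩, ?_⟩
      simp
  refine (Finset.card_le_card hsub).trans (Finset.card_image_le.trans ?_)
  simp [Fintype.card_option]

end Counting

/-! ### Conditional variance of an event. -/

section Gini

open Classical in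
/-- The total `μ`-weight of the points satisfying `P`. -/
noncomputable def mass {Ω : Type*} [Fintype Ω] (μ : Ω → ℝ) (P : Ω → Prop) : ℝ :=
  ∑ ω, if P ω then μ ω else 0

variable {Ω : Type*} [Fintype Ω] {μ : Ω → ℝ}

lemma mass_nonneg (hμ : ∀ ω, 0 ≤ μ ω) (P : Ω → Prop) : 0 ≤ mass μ P :=
  Finset.sum_nonneg fun ω _ => by split_ifs <;> simp [hμ]

lemma mass_mono (hμ : ∀ ω, 0 ≤ μ ω) {P Q : Ω → Prop} (h : ∀ ω, P ω → Q ω) :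
    mass μ P ≤ mass μ Q := by
  refine Finset.sum_le_sum fun ω _ => ?_
  by_cases hP : P ω
  · simp [hP, h ω hP]
  · simp only [hP, if_false]
    split_ifs <;> simp [hμ]

lemma mass_congr {P Q : Ω → Prop} (h : ∀ ω, P ω ↔ Q ω) : mass μ P = mass μ Q := by
  have : P = Q := funext fun ω => propext (h ω)
  rw [this]

lemma mass_add_not (P Q : Ω → Prop) :
    mass μ (fun ω => P ω ∧ Q ω) + mass μ (fun ω => P ω ∧ ¬ Q ω) = mass μ P := by
  classical
  unfold mass
  rw [← Finset.sum_add_distrib]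
  refine Finset.sum_congr rfl fun ω _ => ?_
  by_cases hP : P ω <;> by_cases hQ : Q ω <;> simp [hP, hQ]

lemma sum_mass_fiber {β : Type*} [Fintype β] (κ : Ω → β) (P : Ω → Prop) :
    ∑ v, mass μ (fun ω => κ ω = v ∧ P ω) = mass μ P := by
  classical
  unfold mass
  rw [Finset.sum_comm]
  refine Finset.sum_congr rfl fun ω _ => ?_
  by_cases hP : P ω
  · simp [hP]
  · simp [hP]

lemma mass_prod {Ω' : Type*} [Fintype Ω'] {μ' : Ω' → ℝ} (P : Ω → Prop) (Q : Ω' → Prop) :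
    mass (fun w : Ω × Ω' => μ w.1 * μ' w.2) (fun w => P w.1 ∧ Q w.2) = mass μ P * mass μ' Q := by
  classical
  unfold mass
  rw [Finset.sum_mul_sum, Fintype.sum_prod_type]
  refine Finset.sum_congr rfl fun ω _ => Finset.sum_congr rfl fun ω' _ => ?_
  by_cases hP : P ω <;> by_cases hQ : Q ω' <;> simp [hP, hQ]

/-- The expected conditional variance of the event `B` given the label `κ`. -/
noncomputable def gini {β : Type*} [Fintype β] (μ : Ω → ℝ) (κ : Ω → β) (B : Ω → Prop) : ℝ :=
  ∑ v, mass μ (fun ω => κ ω = v ∧ B ω) * mass μ (fun ω => κ ω = v ∧ ¬ B ω) /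
    mass μ (fun ω => κ ω = v)

/-- The left side is the least squared error of a constant prediction of the event; the right side
is the error of predicting 1 - l. -/
lemma gini_term_le {o z : ℝ} (ho : 0 ≤ o) (hz : 0 ≤ z) (l : ℝ) :
    o * z / (o + z) ≤ l ^ 2 * o + (1 - l) ^ 2 * z := by
  rcases (add_nonneg ho hz).eq_or_lt with h | h
  · rw [← h, div_zero]
    positivity
  · rw [div_le_iff₀ h]
    nlinarith [sq_nonneg (l * o - (1 - l) * z)]

/-- Refining the labels decreases the expected conditional variance. -/
lemma gini_refine (hμ : ∀ ω, 0 ≤ μ ω) {β β' : Type*} [Fintype β] [Fintype β'] (κ : Ω → β')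
    (φ : β' → β) (B : Ω → Prop) : gini μ κ B ≤ gini μ (fun ω => φ (κ ω)) B := by
  classical
  have hfib : ∀ (v : β) (P : Ω → Prop), mass μ (fun ω => φ (κ ω) = v ∧ P ω) =
      ∑ u with φ u = v, mass μ (fun ω => κ ω = u ∧ P ω) := by
    intro v P
    unfold mass
    rw [Finset.sum_comm]
    refine Finset.sum_congr rfl fun ω _ => ?_
    by_cases hP : P ω
    · by_cases hv : φ (κ ω) = v
      · simp only [hv, hP, and_self, if_true, and_true]
        rw [Finset.sum_ite_eq]
        simp [hv]
      · simp only [hv, hP, if_false, and_true]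
        rw [Finset.sum_ite_eq]
        simp [hv]
    · simp [hP]
  unfold gini
  rw [← Finset.sum_fiberwise_of_maps_to (s := Finset.univ) (t := Finset.univ) (g := φ)
    (fun _ _ => Finset.mem_univ _)]
  refine Finset.sum_le_sum fun v _ => ?_
  set O := mass μ (fun ω => φ (κ ω) = v ∧ B ω)
  set Z := mass μ (fun ω => φ (κ ω) = v ∧ ¬ B ω)
  have hS : mass μ (fun ω => φ (κ ω) = v) = O + Z := (mass_add_not _ B).symm
  have hO : 0 ≤ O := mass_nonneg hμ _
  have hZ : 0 ≤ Z := mass_nonneg hμ _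
  rw [hS]
  -- The optimal prediction for the coarse label is used on each finer label.
  set l := Z / (O + Z) with hl
  have hterm : ∀ u ∈ Finset.univ.filter fun u => φ u = v,
      mass μ (fun ω => κ ω = u ∧ B ω) * mass μ (fun ω => κ ω = u ∧ ¬ B ω) /
        mass μ (fun ω => κ ω = u) ≤ l ^ 2 * mass μ (fun ω => κ ω = u ∧ B ω) +
          (1 - l) ^ 2 * mass μ (fun ω => κ ω = u ∧ ¬ B ω) := by
    intro u _
    rw [← mass_add_not (fun ω => κ ω = u) B]
    exact gini_term_le (mass_nonneg hμ _) (mass_nonneg hμ _) l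
  refine (Finset.sum_le_sum hterm).trans ?_
  rw [Finset.sum_add_distrib, ← Finset.mul_sum, ← Finset.mul_sum, ← hfib, ← hfib]
  change l ^ 2 * O + (1 - l) ^ 2 * Z ≤ _
  rcases (add_nonneg hO hZ).eq_or_lt with h | h
  · have h1 : O = 0 := by linarith
    have h2 : Z = 0 := by linarith
    simp [h1, h2]
  · have h1 : 1 - l = O / (O + Z) := by
      rw [hl]
      field_simp
      ring
    rw [h1, hl]
    apply le_of_eq
    field_simp
    ring

/-- Over the common denominator the numerators differ by o₁o₂z₁z₂. -/
lemma gini_prod_term {o₁ z₁ o₂ z₂ : ℝ} (h1 : 0 ≤ o₁) (h2 : 0 ≤ z₁) (h3 : 0 ≤ o₂) (h4 : 0 ≤ z₂) :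
    o₁ * z₁ / (o₁ + z₁) * (z₂ ^ 2 / (o₂ + z₂)) + z₁ ^ 2 / (o₁ + z₁) * (o₂ * z₂ / (o₂ + z₂)) ≤
      ((o₁ + z₁) * (o₂ + z₂) - z₁ * z₂) * (z₁ * z₂) / ((o₁ + z₁) * (o₂ + z₂)) := by
  rw [div_mul_div_comm, div_mul_div_comm, ← add_div]
  refine div_le_div_of_nonneg_right ?_ (by positivity)
  have : 0 ≤ o₁ * o₂ * (z₁ * z₂) := by positivity
  nlinarith

/-- Two independent copies of a rare event have almost twice the variance. -/
lemma gini_prod (hμ : ∀ ω, 0 ≤ μ ω) (hμ1 : ∑ ω, μ ω = 1) {β : Type*} [Fintype β] (κ : Ω → β)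
    (B : Ω → Prop) {p : ℝ} (hp : mass μ B ≤ p) :
    2 * (1 - 2 * p) * gini μ κ B ≤ gini (fun w : Ω × Ω => μ w.1 * μ w.2)
      (fun w => (κ w.1, κ w.2)) (fun w => B w.1 ∨ B w.2) := by
  classical
  set o : β → ℝ := fun v => mass μ (fun ω => κ ω = v ∧ B ω) with ho
  set z : β → ℝ := fun v => mass μ (fun ω => κ ω = v ∧ ¬ B ω) with hz
  have hs : ∀ v, mass μ (fun ω => κ ω = v) = o v + z v := fun v => (mass_add_not _ B).symm
  have o0 : ∀ v, 0 ≤ o v := fun v => mass_nonneg hμ _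
  have z0 : ∀ v, 0 ≤ z v := fun v => mass_nonneg hμ _
  have hg : gini μ κ B = ∑ v, o v * z v / (o v + z v) :=
    Finset.sum_congr rfl fun v _ => by rw [hs]
  have hg0 : 0 ≤ gini μ κ B := by
    rw [hg]
    exact Finset.sum_nonneg fun v _ => div_nonneg (mul_nonneg (o0 v) (z0 v))
      (add_nonneg (o0 v) (z0 v))
  -- Termwise z²/(o + z) ≥ (o + z) - 2o, and the o sum to at most p.
  have hq : 1 - 2 * p ≤ ∑ v, z v ^ 2 / (o v + z v) := by
    have h1 : ∑ v, ((o v + z v) - 2 * o v) ≤ ∑ v, z v ^ 2 / (o v + z v) := by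
      refine Finset.sum_le_sum fun v _ => ?_
      rcases (add_nonneg (o0 v) (z0 v)).eq_or_lt with h | h
      · rw [← h, div_zero]
        linarith [o0 v]
      · rw [le_div_iff₀ h]
        nlinarith [sq_nonneg (o v)]
    have h2 : ∑ v, o v = mass μ B := sum_mass_fiber κ B
    have h3 : ∑ v, (o v + z v) = 1 := by
      have h4 := sum_mass_fiber (μ := μ) κ (fun _ => True)
      simp only [and_true] at h4
      rw [← Finset.sum_congr rfl fun v _ => hs v, h4]
      simp [mass, hμ1]
    rw [Finset.sum_sub_distrib, ← Finset.mul_sum, h2, h3] at h1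
    linarith
  have hZ : ∀ v : β × β, mass (fun w : Ω × Ω => μ w.1 * μ w.2)
      (fun w => (κ w.1, κ w.2) = v ∧ ¬ (B w.1 ∨ B w.2)) = z v.1 * z v.2 := by
    intro v
    rw [hz, ← mass_prod]
    refine mass_congr fun w => ?_
    rw [Prod.ext_iff]
    tauto
  have hS : ∀ v : β × β, mass (fun w : Ω × Ω => μ w.1 * μ w.2)
      (fun w => (κ w.1, κ w.2) = v) = (o v.1 + z v.1) * (o v.2 + z v.2) := by
    intro v
    rw [← hs, ← hs, ← mass_prod]
    refine mass_congr fun w => ?_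
    rw [Prod.ext_iff]
  have hO : ∀ v : β × β, mass (fun w : Ω × Ω => μ w.1 * μ w.2)
      (fun w => (κ w.1, κ w.2) = v ∧ (B w.1 ∨ B w.2)) =
        (o v.1 + z v.1) * (o v.2 + z v.2) - z v.1 * z v.2 := by
    intro v
    rw [← hS, ← hZ, ← mass_add_not (fun w : Ω × Ω => (κ w.1, κ w.2) = v)
      (fun w : Ω × Ω => B w.1 ∨ B w.2)]
    ring
  have hG : gini (fun w : Ω × Ω => μ w.1 * μ w.2) (fun w => (κ w.1, κ w.2))
      (fun w => B w.1 ∨ B w.2) = ∑ v : β × β,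
        ((o v.1 + z v.1) * (o v.2 + z v.2) - z v.1 * z v.2) * (z v.1 * z v.2) /
          ((o v.1 + z v.1) * (o v.2 + z v.2)) :=
    Finset.sum_congr rfl fun v _ => by rw [hO, hZ, hS]
  rw [hG]
  calc 2 * (1 - 2 * p) * gini μ κ B
      ≤ 2 * (∑ v, z v ^ 2 / (o v + z v)) * gini μ κ B := by gcongr
    _ = (∑ v, o v * z v / (o v + z v)) * (∑ v, z v ^ 2 / (o v + z v)) +
        (∑ v, z v ^ 2 / (o v + z v)) * (∑ v, o v * z v / (o v + z v)) := by
        rw [hg]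
        ring
    _ ≤ _ := by
        rw [Finset.sum_mul_sum, Finset.sum_mul_sum, ← Finset.sum_add_distrib,
          Fintype.sum_prod_type]
        refine Finset.sum_le_sum fun v _ => ?_
        rw [← Finset.sum_add_distrib]
        exact Finset.sum_le_sum fun v' _ => gini_prod_term (o0 v) (z0 v) (o0 v') (z0 v')

end Gini

/-! ### Random sets revealed one coordinate at a time. -/

section Spread

variable {m : ℕ}

/-- The elements of `S` below `i`. -/
def pre (i : ℕ) (S : Finset (Fin m)) : Finset (Fin m) := S.filter fun x => x.val < i

lemma mem_pre {i : ℕ} {S : Finset (Fin m)} {x : Fin m} : x ∈ pre i S ↔ x ∈ S ∧ x.val < i := by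
  simp [pre]

lemma pre_union (i : ℕ) (S T : Finset (Fin m)) : pre i (S ∪ T) = pre i S ∪ pre i T :=
  Finset.filter_union _ _ _

lemma pre_zero (S : Finset (Fin m)) : pre 0 S = ∅ := by
  ext x
  simp [mem_pre]

lemma pre_full (S : Finset (Fin m)) : pre m S = S := by
  ext x
  simp [mem_pre]

lemma pre_succ_eq_iff (i : Fin m) (S T : Finset (Fin m)) :
    pre (i.val + 1) S = pre (i.val + 1) T ↔ pre i.val S = pre i.val T ∧ (i ∈ S ↔ i ∈ T) := by
  constructor
  · intro h
    refine ⟨?_, ?_⟩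
    · ext x
      have := Finset.ext_iff.1 h x
      simp only [mem_pre] at this ⊢
      by_cases hx : x.val < i.val
      · simp only [hx, and_true]
        simpa [hx.trans (Nat.lt_succ_self _)] using this
      · simp [hx]
    · have := Finset.ext_iff.1 h i
      simpa [mem_pre] using this
  · rintro ⟨h1, h2⟩
    ext x
    have := Finset.ext_iff.1 h1 x
    simp only [mem_pre] at this ⊢
    rcases lt_trichotomy x.val i.val with hx | hx | hx
    · simpa [hx, hx.trans (Nat.lt_succ_self _)] using this
    · have : x = i := Fin.ext hx
      subst this
      simpa using h2
    · simp [show ¬ x.val < i.val + 1 by omega]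

variable {Ω : Type*} [Fintype Ω]

/-- The weight of the points that agree with `ω` below `i`. -/
noncomputable def atom (μ : Ω → ℝ) (f : Ω → Finset (Fin m)) (i : ℕ) (ω : Ω) : ℝ :=
  mass μ fun ω' => pre i (f ω') = pre i (f ω)

/-- The total expected conditional variance of the coordinates of a random set. -/
noncomputable def totalGini (μ : Ω → ℝ) (f : Ω → Finset (Fin m)) : ℝ :=
  ∑ i : Fin m, gini μ (fun ω => pre i.val (f ω)) (fun ω => i ∈ f ω)

/-- The total conditional surprise of the coordinates of `f ω`. -/
noncomputable def surprise (μ : Ω → ℝ) (f : Ω → Finset (Fin m)) (ω : Ω) : ℝ :=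
  ∑ i : Fin m, (1 - atom μ f (i.val + 1) ω / atom μ f i.val ω)

variable {μ : Ω → ℝ} {f : Ω → Finset (Fin m)}

lemma atom_succ_of_mem {i : Fin m} {ω : Ω} (h : i ∈ f ω) :
    atom μ f (i.val + 1) ω =
      mass μ fun ω' => pre i.val (f ω') = pre i.val (f ω) ∧ i ∈ f ω' := by
  refine mass_congr fun ω' => ?_
  rw [pre_succ_eq_iff]
  simp [h]

lemma atom_succ_of_notMem {i : Fin m} {ω : Ω} (h : i ∉ f ω) :
    atom μ f (i.val + 1) ω =
      mass μ fun ω' => pre i.val (f ω') = pre i.val (f ω) ∧ i ∉ f ω' := by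
  refine mass_congr fun ω' => ?_
  rw [pre_succ_eq_iff]
  simp [h]

lemma atom_nonneg (hμ : ∀ ω, 0 ≤ μ ω) (i : ℕ) (ω : Ω) : 0 ≤ atom μ f i ω := mass_nonneg hμ _

lemma atom_succ_le (hμ : ∀ ω, 0 ≤ μ ω) (i : Fin m) (ω : Ω) :
    atom μ f (i.val + 1) ω ≤ atom μ f i.val ω :=
  mass_mono hμ fun _ h => ((pre_succ_eq_iff i _ _).1 h).1

lemma le_atom (hμ : ∀ ω, 0 ≤ μ ω) (i : ℕ) (ω : Ω) : μ ω ≤ atom μ f i ω := by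
  classical
  have h : mass μ (fun ω' => ω' = ω) = μ ω := by simp [mass]
  rw [← h]
  refine mass_mono hμ ?_
  rintro ω' rfl
  rfl

lemma surprise_term_nonneg (hμ : ∀ ω, 0 ≤ μ ω) (i : Fin m) (ω : Ω) :
    0 ≤ 1 - atom μ f (i.val + 1) ω / atom μ f i.val ω := by
  have := div_le_one_of_le₀ (atom_succ_le (f := f) hμ i ω) (atom_nonneg hμ _ ω)
  linarith

lemma surprise_nonneg (hμ : ∀ ω, 0 ≤ μ ω) (ω : Ω) : 0 ≤ surprise μ f ω :=
  Finset.sum_nonneg fun i _ => surprise_term_nonneg hμ i ω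

/-- Given the prefix, points containing i and points avoiding i each contribute oz/(o + z). -/
lemma sum_surprise (hμ : ∀ ω, 0 ≤ μ ω) :
    ∑ ω, μ ω * surprise μ f ω = 2 * totalGini μ f := by
  classical
  unfold surprise totalGini
  simp_rw [Finset.mul_sum]
  rw [Finset.sum_comm]
  refine Finset.sum_congr rfl fun i _ => ?_
  unfold gini
  rw [Finset.mul_sum, ← Finset.sum_fiberwise_of_maps_to (s := Finset.univ) (t := Finset.univ)
    (g := fun ω => pre i.val (f ω)) (fun _ _ => Finset.mem_univ _)]
  refine Finset.sum_congr rfl fun v _ => ?_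
  set o := mass μ (fun ω => pre i.val (f ω) = v ∧ i ∈ f ω) with ho
  set z := mass μ (fun ω => pre i.val (f ω) = v ∧ ¬ i ∈ f ω) with hz
  have hs : mass μ (fun ω => pre i.val (f ω) = v) = o + z :=
    (mass_add_not _ (fun ω => i ∈ f ω)).symm
  have ho0 : 0 ≤ o := mass_nonneg hμ _
  have hz0 : 0 ≤ z := mass_nonneg hμ _
  rw [hs]
  have hterm : ∀ ω ∈ Finset.univ.filter (fun ω => pre i.val (f ω) = v),
      μ ω * (1 - atom μ f (i.val + 1) ω / atom μ f i.val ω) =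
        (if i ∈ f ω then μ ω else 0) * (z / (o + z)) +
          (if ¬ i ∈ f ω then μ ω else 0) * (o / (o + z)) := by
    intro ω hω
    have hv : pre i.val (f ω) = v := (Finset.mem_filter.1 hω).2
    have hA : atom μ f i.val ω = o + z := by
      rw [← hs, ← hv]
      rfl
    rcases (hμ ω).eq_or_lt with h0 | h0
    · simp [← h0]
    have hpos : 0 < o + z := hA ▸ h0.trans_le (le_atom hμ _ ω)
    by_cases hi : i ∈ f ω
    · have : atom μ f (i.val + 1) ω = o := by rw [atom_succ_of_mem hi, hv]
      rw [this, hA]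
      simp only [hi, not_true, if_true, if_false]
      field_simp
      ring
    · have : atom μ f (i.val + 1) ω = z := by rw [atom_succ_of_notMem hi, hv]
      rw [this, hA]
      simp only [hi, not_false_iff, if_true, if_false]
      field_simp
      ring
  rw [Finset.sum_congr rfl hterm, Finset.sum_add_distrib, ← Finset.sum_mul, ← Finset.sum_mul]
  have e1 : ∑ ω with pre i.val (f ω) = v, (if i ∈ f ω then μ ω else 0) = o := by
    rw [ho, mass, Finset.sum_filter]
    refine Finset.sum_congr rfl fun ω _ => ?_
    by_cases h1 : pre i.val (f ω) = v <;> simp [h1]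
  have e2 : ∑ ω with pre i.val (f ω) = v, (if ¬ i ∈ f ω then μ ω else 0) = z := by
    rw [hz, mass, Finset.sum_filter]
    refine Finset.sum_congr rfl fun ω _ => ?_
    by_cases h1 : pre i.val (f ω) = v <;> simp [h1]
  rw [e1, e2]
  ring

end Spread

/-! ### Union-closed families with rare points and short lists. -/

section Spread

variable {m : ℕ} {Ω : Type*} [Fintype Ω] {μ : Ω → ℝ} {f : Ω → Finset (Fin m)}

lemma gini_nonneg (hμ : ∀ ω, 0 ≤ μ ω) {β : Type*} [Fintype β] (κ : Ω → β) (B : Ω → Prop) :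
    0 ≤ gini μ κ B :=
  Finset.sum_nonneg fun _ _ => div_nonneg (mul_nonneg (mass_nonneg hμ _) (mass_nonneg hμ _))
    (mass_nonneg hμ _)

lemma totalGini_nonneg (hμ : ∀ ω, 0 ≤ μ ω) : 0 ≤ totalGini μ f :=
  Finset.sum_nonneg fun _ _ => gini_nonneg hμ _ _

/-- Termwise 1 - x ≤ -log x, and the logarithms of the conditional probabilities telescope. -/
lemma surprise_le_log (hμ : ∀ ω, 0 ≤ μ ω) (hμ1 : ∑ ω, μ ω = 1) {ω : Ω} (hω : 0 < μ ω) :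
    surprise μ f ω ≤ - Real.log (atom μ f m ω) := by
  have hpos : ∀ i, 0 < atom μ f i ω := fun i => hω.trans_le (le_atom hμ i ω)
  have hterm : ∀ i ∈ Finset.range m, 1 - atom μ f (i + 1) ω / atom μ f i ω ≤
      Real.log (atom μ f i ω) - Real.log (atom μ f (i + 1) ω) := by
    intro i _
    have h1 := Real.one_sub_inv_le_log_of_pos (div_pos (hpos i) (hpos (i + 1)))
    rwa [inv_div, Real.log_div (hpos i).ne' (hpos (i + 1)).ne'] at h1
  have h0 : atom μ f 0 ω = 1 := by
    simp [atom, pre_zero, mass, hμ1]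
  unfold surprise
  rw [Fin.sum_univ_eq_sum_range (fun i => 1 - atom μ f (i + 1) ω / atom μ f i ω) m]
  refine (Finset.sum_le_sum hterm).trans ?_
  rw [Finset.sum_range_sub', h0]
  simp

/-- The total variance is bounded by the logarithm of the number of values. -/
lemma two_mul_totalGini_le (hμ : ∀ ω, 0 ≤ μ ω) (hμ1 : ∑ ω, μ ω = 1)
    {F : Finset (Finset (Fin m))} (hF : ∀ ω, f ω ∈ F) :
    2 * totalGini μ f ≤ Real.log F.card := by
  classical
  obtain ⟨ω0⟩ : Nonempty Ω := by
    by_contra hne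
    rw [not_nonempty_iff] at hne
    simp at hμ1
  have hN : (0 : ℝ) < F.card := by exact_mod_cast Finset.card_pos.2 ⟨_, hF ω0⟩
  rw [← sum_surprise hμ]
  -- The mean of -log of the atoms is an entropy; log x ≤ x - 1 compares it with that of the uniform
  -- distribution on F.
  have hterm : ∀ ω ∈ Finset.univ, μ ω * surprise μ f ω ≤
      μ ω * (Real.log F.card - 1) + μ ω / atom μ f m ω / F.card := by
    intro ω _
    rcases (hμ ω).eq_or_lt with h | h
    · simp [← h]
    · have h1 := surprise_le_log (f := f) hμ hμ1 h
      have hA : 0 < atom μ f m ω := h.trans_le (le_atom hμ m ω)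
      have h2 := Real.log_le_sub_one_of_pos (show 0 < 1 / (atom μ f m ω * F.card) by positivity)
      rw [one_div, Real.log_inv, Real.log_mul hA.ne' hN.ne'] at h2
      have h3 : surprise μ f ω ≤ (Real.log F.card - 1) + (atom μ f m ω * F.card)⁻¹ := by linarith
      calc μ ω * surprise μ f ω ≤ μ ω * ((Real.log F.card - 1) + (atom μ f m ω * F.card)⁻¹) := by
            gcongr
        _ = _ := by
            field_simp
  refine (Finset.sum_le_sum hterm).trans ?_
  rw [Finset.sum_add_distrib, ← Finset.sum_mul, hμ1, ← Finset.sum_div]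
  have h4 : ∑ ω, μ ω / atom μ f m ω ≤ F.card := by
    rw [← Finset.sum_fiberwise_of_maps_to (s := Finset.univ) (t := F) (g := f)
      (fun ω _ => hF ω)]
    calc _ ≤ ∑ _v ∈ F, (1 : ℝ) := by
          refine Finset.sum_le_sum fun v _ => ?_
          have h5 : ∑ ω with f ω = v, μ ω / atom μ f m ω =
              (∑ ω with f ω = v, μ ω) / mass μ fun ω => f ω = v := by
            rw [Finset.sum_div]
            refine Finset.sum_congr rfl fun ω hω => ?_
            rw [← (Finset.mem_filter.1 hω).2]
            simp only [atom, pre_full]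
          have h6 : (mass μ fun ω => f ω = v) = ∑ ω with f ω = v, μ ω := by
            rw [mass, Finset.sum_filter]
            refine Finset.sum_congr rfl fun ω _ => ?_
            by_cases h1 : f ω = v <;> simp [h1]
          rw [h5, h6]
          exact div_self_le_one _
      _ = F.card := by simp
  have h5 : (∑ ω, μ ω / atom μ f m ω) / F.card ≤ 1 := (div_le_one hN).2 h4
  linarith

lemma mass_or_le (hμ : ∀ ω, 0 ≤ μ ω) (hμ1 : ∑ ω, μ ω = 1) (B : Ω → Prop) :
    mass (fun w : Ω × Ω => μ w.1 * μ w.2) (fun w => B w.1 ∨ B w.2) ≤ 2 * mass μ B := by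
  classical
  have e1 : mass (fun w : Ω × Ω => μ w.1 * μ w.2) (fun w => B w.1 ∧ True) = mass μ B := by
    rw [mass_prod B (fun _ => True)]
    simp [mass, hμ1]
  have e2 : mass (fun w : Ω × Ω => μ w.1 * μ w.2) (fun w => True ∧ B w.2) = mass μ B := by
    rw [mass_prod (fun _ => True) B]
    simp [mass, hμ1]
  rw [two_mul]
  nth_rewrite 1 [← e1]
  rw [← e2]
  unfold mass
  rw [← Finset.sum_add_distrib]
  refine Finset.sum_le_sum fun w _ => ?_
  have := mul_nonneg (hμ w.1) (hμ w.2)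
  by_cases h1 : B w.1 <;> by_cases h2 : B w.2 <;> simp [h1, h2, this]

/-- Pairs of prefixes refine the prefix of the union, so passing to the latter can only raise the
variance given by `gini_prod`. -/
lemma totalGini_union (hμ : ∀ ω, 0 ≤ μ ω) (hμ1 : ∑ ω, μ ω = 1) {p : ℝ}
    (hp : ∀ i, mass μ (fun ω => i ∈ f ω) ≤ p) :
    2 * (1 - 2 * p) * totalGini μ f ≤
      totalGini (fun w : Ω × Ω => μ w.1 * μ w.2) (fun w => f w.1 ∪ f w.2) := by
  unfold totalGini
  rw [Finset.mul_sum]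
  refine Finset.sum_le_sum fun i _ => ?_
  refine (gini_prod hμ hμ1 _ _ (hp i)).trans ?_
  have := gini_refine (μ := fun w : Ω × Ω => μ w.1 * μ w.2)
    (fun w => mul_nonneg (hμ w.1) (hμ w.2)) (fun w => (pre i.val (f w.1), pre i.val (f w.2)))
    (fun v => v.1 ∪ v.2) (fun w => i ∈ f w.1 ∨ i ∈ f w.2)
  refine this.trans (le_of_eq ?_)
  congr 1
  · ext1 w
    exact (pre_union _ _ _).symm
  · ext1 w
    rw [Finset.mem_union]

/-- A random member of a union-closed family in which every element is rare has small total
variance. -/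
lemma totalGini_le_of_unionClosed {F : Finset (Finset (Fin m))}
    (hcl : ∀ S ∈ F, ∀ T ∈ F, S ∪ T ∈ F) (s : ℕ) :
    ∀ {Ω : Type*} [Fintype Ω] {μ : Ω → ℝ} {f : Ω → Finset (Fin m)} (_ : ∀ ω, 0 ≤ μ ω)
      (_ : ∑ ω, μ ω = 1) (_ : ∀ ω, f ω ∈ F) {p : ℝ} (_ : 0 ≤ p) (_ : 2 ^ (s + 1) * p ≤ 1 / 2)
      (_ : ∀ i, mass μ (fun ω => i ∈ f ω) ≤ p),
      2 ^ s * (1 - (2 ^ (s + 1) - 2) * p) * (2 * totalGini μ f) ≤ Real.log F.card := by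
  induction s with
  | zero =>
    intro Ω _ μ f hμ hμ1 hF p hp0 hps hp
    simpa using two_mul_totalGini_le hμ hμ1 hF
  | succ s ih =>
    intro Ω _ μ f hμ hμ1 hF p hp0 hps hp
    -- The union of two independent copies stays in F and at most doubles the frequency of each
    -- point. The induction ranges over all probability spaces so that Ω may be replaced by Ω × Ω.
    have h1 := ih (Ω := Ω × Ω) (μ := fun w => μ w.1 * μ w.2) (f := fun w => f w.1 ∪ f w.2)
      (fun w => mul_nonneg (hμ _) (hμ _))
      (by rw [Fintype.sum_prod_type, ← Finset.sum_mul_sum, hμ1, mul_one])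
      (fun w => hcl _ (hF _) _ (hF _)) (p := 2 * p) (by linarith)
      (by rw [← mul_assoc, ← pow_succ]; exact hps)
      (fun i => by
        refine le_trans (le_of_eq (mass_congr fun w => Finset.mem_union)) ?_
        refine (mass_or_le hμ hμ1 fun ω => i ∈ f ω).trans ?_
        linarith [hp i])
    have h2 := totalGini_union hμ hμ1 hp
    have hG := totalGini_nonneg (f := f) hμ
    refine le_trans ?_ h1
    set a : ℝ := 2 ^ s with ha
    have ha1 : 1 ≤ a := one_le_pow₀ (by norm_num)
    have e1 : (2 : ℝ) ^ (s + 1) = 2 * a := by rw [pow_succ]; ring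
    have e2 : (2 : ℝ) ^ (s + 1 + 1) = 4 * a := by rw [pow_succ, e1]; ring
    rw [e2] at hps ⊢
    rw [e1]
    have h3 : 0 ≤ 1 - (2 * a - 2) * (2 * p) := by nlinarith
    have h4 : (1 - (4 * a - 2) * p) ≤ (1 - (2 * a - 2) * (2 * p)) * (1 - 2 * p) := by
      nlinarith [mul_nonneg (mul_nonneg (by linarith : (0 : ℝ) ≤ 2 * a - 2) hp0) hp0]
    calc 2 * a * (1 - (4 * a - 2) * p) * (2 * totalGini μ f)
        ≤ 2 * a * ((1 - (2 * a - 2) * (2 * p)) * (1 - 2 * p)) * (2 * totalGini μ f) := by gcongr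
      _ = a * (1 - (2 * a - 2) * (2 * p)) * (2 * (2 * (1 - 2 * p) * totalGini μ f)) := by ring
      _ ≤ _ := by gcongr

/-- The coordinates at which `f ω` takes the less likely value. -/
noncomputable def minority (μ : Ω → ℝ) (f : Ω → Finset (Fin m)) (ω : Ω) : Finset (Fin m) := by
  classical exact Finset.univ.filter fun i =>
    2 * atom μ f (i.val + 1) ω < atom μ f i.val ω ∨
      (2 * atom μ f (i.val + 1) ω = atom μ f i.val ω ∧ i ∈ f ω)

lemma mem_minority {ω : Ω} {i : Fin m} : i ∈ minority μ f ω ↔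
    2 * atom μ f (i.val + 1) ω < atom μ f i.val ω ∨
      (2 * atom μ f (i.val + 1) ω = atom μ f i.val ω ∧ i ∈ f ω) := by
  classical
  simp [minority]

/-- Decoding goes upwards: the prefix fixes the two conditional masses, and the minority set says
whether the lighter value is taken. In a tie, membership in f itself decides, so the two values stay
distinguished. -/
lemma eq_of_minority_eq {ω ω' : Ω} (h : minority μ f ω = minority μ f ω') : f ω = f ω' := by
  have key : ∀ i ≤ m, pre i (f ω) = pre i (f ω') := by
    intro i
    induction i with
    | zero => simp [pre_zero]
    | succ i ih =>
      intro hi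
      have hv := ih (by omega)
      have hat : atom μ f i ω = atom μ f i ω' := by
        unfold atom
        rw [hv]
      refine (pre_succ_eq_iff ⟨i, hi⟩ _ _).2 ⟨hv, ?_⟩
      have hD := Finset.ext_iff.1 h ⟨i, hi⟩
      rw [mem_minority, mem_minority] at hD
      simp only at hD
      by_cases h1 : (⟨i, hi⟩ : Fin m) ∈ f ω <;> by_cases h2 : (⟨i, hi⟩ : Fin m) ∈ f ω'
      · simp [h1, h2]
      · exfalso
        have e1 := atom_succ_of_mem (μ := μ) h1
        have e2 := atom_succ_of_notMem (μ := μ) h2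
        simp only at e1 e2
        rw [hv] at e1
        have e3 := mass_add_not (μ := μ) (fun ω'' => pre i (f ω'') = pre i (f ω'))
          (fun ω'' => (⟨i, hi⟩ : Fin m) ∈ f ω'')
        rw [← e1, ← e2] at e3
        have e4 : atom μ f i ω' = atom μ f (i + 1) ω + atom μ f (i + 1) ω' := e3.symm
        simp only [h1, h2, and_true, and_false, or_false, hat, e4] at hD
        rcases lt_trichotomy (atom μ f (i + 1) ω) (atom μ f (i + 1) ω') with g | g | g
        · have := hD.1 (Or.inl (by linarith))
          linarith
        · have := hD.1 (Or.inr (by linarith))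
          linarith
        · rcases hD.2 (by linarith) with g' | g' <;> linarith
      · exfalso
        have e1 := atom_succ_of_notMem (μ := μ) h1
        have e2 := atom_succ_of_mem (μ := μ) h2
        simp only at e1 e2
        rw [hv] at e1
        have e3 := mass_add_not (μ := μ) (fun ω'' => pre i (f ω'') = pre i (f ω'))
          (fun ω'' => (⟨i, hi⟩ : Fin m) ∈ f ω'')
        rw [← e1, ← e2] at e3
        have e4 : atom μ f i ω' = atom μ f (i + 1) ω' + atom μ f (i + 1) ω := e3.symm
        simp only [h1, h2, and_true, and_false, or_false, hat, e4] at hD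
        rcases lt_trichotomy (atom μ f (i + 1) ω') (atom μ f (i + 1) ω) with g | g | g
        · have := hD.2 (Or.inl (by linarith))
          linarith
        · have := hD.2 (Or.inr (by linarith))
          linarith
        · rcases hD.1 (by linarith) with g' | g' <;> linarith
      · simp [h1, h2]
  have := key m le_rfl
  rwa [pre_full, pre_full] at this

/-- A minority value has conditional probability at most 1/2, hence surprise at least 1/2. -/
lemma card_minority_le (hμ : ∀ ω, 0 ≤ μ ω) (ω : Ω) :
    ((minority μ f ω).card : ℝ) ≤ 2 * surprise μ f ω := by
  classical
  have h1 : ((minority μ f ω).card : ℝ) = ∑ i : Fin m, if i ∈ minority μ f ω then 1 else 0 := by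
    simp
  rw [h1, surprise, Finset.mul_sum]
  refine Finset.sum_le_sum fun i _ => ?_
  split_ifs with hi
  · have h2 : 2 * atom μ f (i.val + 1) ω ≤ atom μ f i.val ω := by
      rcases mem_minority.1 hi with h | h
      · exact h.le
      · exact h.1.le
    have h3 : atom μ f (i.val + 1) ω / atom μ f i.val ω ≤ 1 / 2 := by
      refine div_le_of_le_mul₀ (atom_nonneg hμ _ _) (by norm_num) ?_
      linarith
    linarith
  · have := surprise_term_nonneg (f := f) hμ i ω
    linarith

open Classical in
/-- There are few sets with a small surprise. -/
lemma card_image_surprise_le (hμ : ∀ ω, 0 ≤ μ ω) (γ : ℝ) :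
    ((Finset.univ.filter fun ω => surprise μ f ω ≤ γ).image f).card ≤ (m + 1) ^ ⌊2 * γ⌋₊ := by
  have h1 : ((Finset.univ.filter fun ω => surprise μ f ω ≤ γ).image f).card ≤
      ((Finset.univ.filter fun ω => surprise μ f ω ≤ γ).image (minority μ f)).card := by
    have hfac : ∃ g : Finset (Fin m) → Finset (Fin m), ∀ ω, g (minority μ f ω) = f ω := by
      refine ⟨fun D => if h : ∃ ω, minority μ f ω = D then f h.choose else ∅, fun ω => ?_⟩
      have h : ∃ ω', minority μ f ω' = minority μ f ω := ⟨ω, rfl⟩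
      simp only [dif_pos h]
      exact eq_of_minority_eq h.choose_spec
    obtain ⟨g, hg⟩ := hfac
    have : (Finset.univ.filter fun ω => surprise μ f ω ≤ γ).image f =
        ((Finset.univ.filter fun ω => surprise μ f ω ≤ γ).image (minority μ f)).image g := by
      rw [Finset.image_image]
      exact Finset.image_congr fun ω _ => (hg ω).symm
    rw [this]
    exact Finset.card_image_le
  refine h1.trans ?_
  have h2 := card_subsets_le (α := Fin m) ⌊2 * γ⌋₊
  rw [Fintype.card_fin] at h2
  refine (Finset.card_le_card ?_).trans h2
  intro D hD
  obtain ⟨ω, hω, rfl⟩ := Finset.mem_image.1 hD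
  refine Finset.mem_filter.2 ⟨Finset.mem_univ _, Nat.le_floor ?_⟩
  exact (card_minority_le hμ ω).trans (by linarith [(Finset.mem_filter.1 hω).2])

open Classical in
/-- A random member of a union-closed family in which every element is rare lies in a short list
with probability at least `9 / 10`. -/
lemma exists_list_of_unionClosed {F : Finset (Finset (Fin m))}
    (hcl : ∀ S ∈ F, ∀ T ∈ F, S ∪ T ∈ F) (hμ : ∀ ω, 0 ≤ μ ω) (hμ1 : ∑ ω, μ ω = 1)
    (hF : ∀ ω, f ω ∈ F) (s : ℕ) (hp : ∀ i, mass μ (fun ω => i ∈ f ω) ≤ 1 / 2 ^ (s + 2)) :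
    ∃ P : Finset (Finset (Fin m)), P.card ≤ (m + 1) ^ ⌊40 * Real.log F.card / 2 ^ s⌋₊ ∧
      9 / 10 ≤ mass μ fun ω => f ω ∈ P := by
  have h1 := totalGini_le_of_unionClosed hcl s hμ hμ1 hF (p := 1 / 2 ^ (s + 2)) (by positivity)
    (by rw [pow_succ 2 (s + 1)]; field_simp; norm_num) hp
  have hG := totalGini_nonneg (f := f) hμ
  have h2 : 2 ^ s * (2 * totalGini μ f) ≤ 2 * Real.log F.card := by
    have h3 : (1 : ℝ) / 2 ≤ 1 - (2 ^ (s + 1) - 2) * (1 / 2 ^ (s + 2)) := by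
      have : (2 : ℝ) ^ (s + 1) * (1 / 2 ^ (s + 2)) = 1 / 2 := by
        rw [pow_succ 2 (s + 1)]
        field_simp
      have : (0 : ℝ) < 1 / 2 ^ (s + 2) := by positivity
      nlinarith
    have h4 : 2 ^ s * (1 / 2) * (2 * totalGini μ f) ≤ Real.log F.card :=
      le_trans (by gcongr) h1
    linarith
  -- Ten times the bound on the mean surprise, so Markov's inequality loses at most 1/10 of the
  -- mass; γ = 0 is treated apart.
  set γ : ℝ := 20 * Real.log F.card / 2 ^ s with hγ
  have hγ0 : 0 ≤ γ := by
    have := Real.log_natCast_nonneg F.card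
    positivity
  have hE : 10 * ∑ ω, μ ω * surprise μ f ω ≤ γ := by
    rw [sum_surprise hμ, hγ, le_div_iff₀ (by positivity)]
    linarith
  refine ⟨(Finset.univ.filter fun ω => surprise μ f ω ≤ γ).image f, ?_, ?_⟩
  · have := card_image_surprise_le (f := f) hμ γ
    rwa [show 2 * γ = 40 * Real.log F.card / 2 ^ s by rw [hγ]; ring] at this
  · have hgood : 9 / 10 ≤ mass μ fun ω => surprise μ f ω ≤ γ := by
      rcases hγ0.eq_or_lt with h0 | h0
      · have hz : ∑ ω, μ ω * surprise μ f ω = 0 := by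
          refine le_antisymm (by linarith) (Finset.sum_nonneg fun ω _ =>
            mul_nonneg (hμ ω) (surprise_nonneg hμ ω))
        rw [Finset.sum_eq_zero_iff_of_nonneg fun ω _ =>
          mul_nonneg (hμ ω) (surprise_nonneg hμ ω)] at hz
        have : mass μ (fun ω => surprise μ f ω ≤ γ) = 1 := by
          rw [← hμ1]
          refine Finset.sum_congr rfl fun ω _ => ?_
          split_ifs with h
          · rfl
          · rcases mul_eq_zero.1 (hz ω (Finset.mem_univ _)) with h' | h'
            · exact h'.symm
            · exact absurd (show surprise μ f ω ≤ γ by rw [h', ← h0]) h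
        rw [this]
        norm_num
      · have h5 : γ * mass μ (fun ω => ¬ surprise μ f ω ≤ γ) ≤ ∑ ω, μ ω * surprise μ f ω := by
          unfold mass
          rw [Finset.mul_sum]
          refine Finset.sum_le_sum fun ω _ => ?_
          split_ifs with h
          · rw [mul_comm]
            exact mul_le_mul_of_nonneg_left (not_le.1 h).le (hμ ω)
          · rw [mul_zero]
            exact mul_nonneg (hμ ω) (surprise_nonneg hμ ω)
        have h6 := mass_add_not (μ := μ) (fun _ => True) (fun ω => surprise μ f ω ≤ γ)
        have h7 : mass μ (fun _ => True) = 1 := by simp [mass, hμ1]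
        rw [h7] at h6
        simp only [true_and] at h6
        have h8 : mass μ (fun ω => ¬ surprise μ f ω ≤ γ) ≤ 1 / 10 := by
          by_contra hcon
          push Not at hcon
          simp only [not_le] at h5 hcon
          nlinarith
        linarith
    refine hgood.trans (mass_mono hμ fun ω h => ?_)
    exact Finset.mem_image_of_mem f (Finset.mem_filter.2 ⟨Finset.mem_univ _, h⟩)

end Spread

/-! ### Non-redundant sets and union closure. -/

section Families

variable {α : Type*} [DecidableEq α]

/-- Every non-redundant set of points for the family `F` has at most `k` elements. -/
def NonRedundantLE (F : Finset (Finset α)) (k : ℕ) : Prop :=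
  ∀ I : Finset α, (∀ i ∈ I, ∃ S ∈ F, S ∩ I = {i}) → I.card ≤ k

lemma NonRedundantLE.mono {F G : Finset (Finset α)} {k : ℕ} (h : NonRedundantLE F k)
    (hG : G ⊆ F) : NonRedundantLE G k := fun I hI => h I fun i hi =>
  let ⟨S, hS, hSI⟩ := hI i hi
  ⟨S, hG hS, hSI⟩

lemma NonRedundantLE.inter {F : Finset (Finset α)} {k : ℕ} (h : NonRedundantLE F k)
    (J : Finset α) : NonRedundantLE (F.image (· ∩ J)) k := by
  intro I hI
  have hIJ : I ⊆ J := by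
    intro i hi
    obtain ⟨T, hT, hTI⟩ := hI i hi
    obtain ⟨S, -, rfl⟩ := Finset.mem_image.1 hT
    have : i ∈ S ∩ J ∩ I := by rw [hTI]; exact Finset.mem_singleton_self i
    exact (Finset.mem_inter.1 (Finset.mem_inter.1 this).1).2
  refine h I fun i hi => ?_
  obtain ⟨T, hT, hTI⟩ := hI i hi
  obtain ⟨S, hS, rfl⟩ := Finset.mem_image.1 hT
  refine ⟨S, hS, ?_⟩
  rw [← hTI, Finset.inter_assoc, Finset.inter_eq_right.2 hIJ]

/-- A family is contained in a union-closed family whose size is controlled by the size of the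
largest non-redundant set. -/
lemma NonRedundantLE.exists_unionClosed [Fintype α] {F : Finset (Finset α)} {k : ℕ}
    (h : NonRedundantLE F k) :
    ∃ F' : Finset (Finset α), F ⊆ F' ∧ (∀ S ∈ F', ∀ T ∈ F', S ∪ T ∈ F') ∧
      F'.card ≤ (Fintype.card α + 1) ^ k := by
  refine ⟨F.powerset.image fun A => A.sup id, ?_, ?_, ?_⟩
  · intro S hS
    exact Finset.mem_image.2 ⟨{S}, by simpa using hS, by simp⟩
  · intro S hS T hT
    obtain ⟨A, hA, rfl⟩ := Finset.mem_image.1 hS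
    obtain ⟨B, hB, rfl⟩ := Finset.mem_image.1 hT
    refine Finset.mem_image.2 ⟨A ∪ B, ?_, ?_⟩
    · rw [Finset.mem_powerset] at *
      exact Finset.union_subset hA hB
    · rw [Finset.sup_union]
      rfl
  -- A family is no larger than its collection of shattered sets. If a union isolates i inside I, so
  -- does any of its members that contains i; thus a set shattered by the closure is non-redundant
  -- for F.
  · refine (Finset.card_le_card_shatterer _).trans (le_trans (Finset.card_le_card ?_)
      (card_subsets_le k))
    intro I hI
    refine Finset.mem_filter.2 ⟨Finset.mem_univ _, h I fun i hi => ?_⟩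
    obtain ⟨S, hS, hSI⟩ := (Finset.mem_shatterer.1 hI).exists_inter_eq_singleton hi
    obtain ⟨A, hA, rfl⟩ := Finset.mem_image.1 hS
    have hiS : i ∈ A.sup id := by
      have : i ∈ I ∩ A.sup id := by rw [hSI]; exact Finset.mem_singleton_self i
      exact (Finset.mem_inter.1 this).2
    obtain ⟨T, hT, hiT⟩ := Finset.mem_sup.1 hiS
    refine ⟨T, Finset.mem_powerset.1 hA hT, ?_⟩
    have hTs : T ≤ A.sup id := Finset.le_sup (f := id) hT
    ext x
    rw [Finset.mem_inter, Finset.mem_singleton]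
    constructor
    · rintro ⟨hx, hxI⟩
      have : x ∈ I ∩ A.sup id := Finset.mem_inter.2 ⟨hxI, hTs hx⟩
      rw [hSI] at this
      exact Finset.mem_singleton.1 this
    · rintro rfl
      exact ⟨hiT, hi⟩

end Families

/-! ### Multiplicative weights and random covers. -/

section Boosting

open Classical in
/-- The multiplicative weights method. -/
lemma exists_boost_weights {σ τ : Type*} (G : Finset σ) (good : τ → σ → Prop)
    (oracle : ∀ w : σ → ℝ, (∀ S ∈ G, 0 < w S) →
      ∃ x : τ, 9 / 10 * ∑ S ∈ G, w S ≤ ∑ S ∈ G with good x S, w S) (R : ℕ) :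
    ∃ x : Fin R → τ, ∑ S ∈ G, (1 / 2 : ℝ) ^ (Finset.univ.filter fun r => good (x r) S).card ≤
      G.card * (55 / 100) ^ R := by
  induction R with
  | zero => exact ⟨Fin.elim0, by simp⟩
  | succ R ih =>
    obtain ⟨x, hx⟩ := ih
    -- Each round halves the weight of the sets served, at least 9/10 of the total, leaving a factor
    -- 1 - 9/20 = 55/100.
    obtain ⟨y, hy⟩ := oracle
      (fun S => (1 / 2 : ℝ) ^ (Finset.univ.filter fun r => good (x r) S).card)
      (fun S _ => by positivity)
    refine ⟨Fin.cons y x, ?_⟩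
    have hterm : ∀ S ∈ G, (1 / 2 : ℝ) ^ (Finset.univ.filter fun r =>
        good ((Fin.cons y x : Fin (R + 1) → τ) r) S).card =
        (1 / 2 : ℝ) ^ (Finset.univ.filter fun r => good (x r) S).card -
          1 / 2 * (if good y S then
            (1 / 2 : ℝ) ^ (Finset.univ.filter fun r => good (x r) S).card else 0) := by
      intro S _
      have hc : (Finset.univ.filter fun r => good ((Fin.cons y x : Fin (R + 1) → τ) r) S).card =
          (if good y S then 1 else 0) + (Finset.univ.filter fun r => good (x r) S).card := by
        rw [Finset.card_filter, Fin.sum_univ_succ, Finset.card_filter]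
        simp
      rw [hc]
      split_ifs with h
      · rw [pow_add]
        ring
      · simp
    rw [Finset.sum_congr rfl hterm, Finset.sum_sub_distrib, ← Finset.mul_sum, ← Finset.sum_filter]
    rw [pow_succ]
    linarith

-- A set served fewer than 9m times would alone weigh at least 2^{-9m}, but the total is at most 2^m
-- · 0.55^{12m}, and 2 · 0.55¹² < 2⁻⁹.
open Classical in
lemma exists_boost {σ τ : Type*} (G : Finset σ) (good : τ → σ → Prop)
    (oracle : ∀ w : σ → ℝ, (∀ S ∈ G, 0 < w S) →
      ∃ x : τ, 9 / 10 * ∑ S ∈ G, w S ≤ ∑ S ∈ G with good x S, w S) {m : ℕ} (hm : 1 ≤ m)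
    (hG : G.card ≤ 2 ^ m) :
    ∃ x : Fin (12 * m) → τ, ∀ S ∈ G, 9 * m ≤ (Finset.univ.filter fun r => good (x r) S).card := by
  obtain ⟨x, hx⟩ := exists_boost_weights G good oracle (12 * m)
  refine ⟨x, fun S hS => ?_⟩
  by_contra hcon
  push Not at hcon
  have h1 : (1 / 2 : ℝ) ^ (9 * m) ≤ 2 ^ m * (55 / 100) ^ (12 * m) := by
    calc (1 / 2 : ℝ) ^ (9 * m) ≤
          (1 / 2 : ℝ) ^ (Finset.univ.filter fun r => good (x r) S).card :=
          pow_le_pow_of_le_one (by norm_num) (by norm_num) hcon.le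
      _ ≤ ∑ S ∈ G, (1 / 2 : ℝ) ^ (Finset.univ.filter fun r => good (x r) S).card :=
          Finset.single_le_sum (f := fun S =>
            (1 / 2 : ℝ) ^ (Finset.univ.filter fun r => good (x r) S).card)
            (fun _ _ => by positivity) hS
      _ ≤ G.card * (55 / 100) ^ (12 * m) := hx
      _ ≤ _ := by
          gcongr
          exact_mod_cast hG
  rw [pow_mul, pow_mul, ← mul_pow] at h1
  exact absurd h1 (not_le.2 (pow_lt_pow_left₀ (by norm_num) (by positivity) (by omega)))

/-- If every element of `T` lies in at least half of the sets `J r`, then a few of these sets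
cover `T`. -/
lemma exists_cover {ρ α : Type*} [DecidableEq α] (Q : Finset ρ) (hQ : Q.Nonempty) (J : ρ → Finset α)
    (T : Finset α) (h : ∀ i ∈ T, 2 * (Q.filter fun r => i ∉ J r).card ≤ Q.card) (K : ℕ) :
    ∃ r : Fin K → ρ, (∀ j, r j ∈ Q) ∧
      2 ^ K * (T.filter fun i => ∀ j, i ∉ J (r j)).card ≤ T.card := by
  induction K with
  | zero => exact ⟨Fin.elim0, fun j => j.elim0, by simp⟩
  | succ K ih =>
    obtain ⟨r, hr, hc⟩ := ih
    set V := T.filter fun i => ∀ j, i ∉ J (r j) with hV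
    -- Averaging over Q, some J q misses at most half of the points still uncovered.
    obtain ⟨q, hq, hqm⟩ := Q.exists_min_image (fun q => (V.filter fun i => i ∉ J q).card) hQ
    have hsum : Q.card * (2 * (V.filter fun i => i ∉ J q).card) ≤ Q.card * V.card := by
      calc Q.card * (2 * (V.filter fun i => i ∉ J q).card)
          = 2 * ∑ _q' ∈ Q, (V.filter fun i => i ∉ J q).card := by
            rw [Finset.sum_const, smul_eq_mul]
            ring
        _ ≤ 2 * ∑ q' ∈ Q, (V.filter fun i => i ∉ J q').card := by
            exact Nat.mul_le_mul_left _ (Finset.sum_le_sum hqm)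
        _ = 2 * ∑ i ∈ V, (Q.filter fun q' => i ∉ J q').card := by
            simp only [Finset.card_filter]
            rw [Finset.sum_comm]
        _ = ∑ i ∈ V, 2 * (Q.filter fun q' => i ∉ J q').card := Finset.mul_sum _ _ _
        _ ≤ ∑ _i ∈ V, Q.card := Finset.sum_le_sum fun i hi => h i (Finset.mem_filter.1 hi).1
        _ = Q.card * V.card := by
            rw [Finset.sum_const, smul_eq_mul, mul_comm]
    have h2 := Nat.le_of_mul_le_mul_left hsum hQ.card_pos
    refine ⟨Fin.cons q r, fun j => ?_, ?_⟩
    · refine Fin.cases ?_ (fun j => ?_) j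
      · exact hq
      · exact hr j
    · have he : (T.filter fun i => ∀ j, i ∉ J ((Fin.cons q r : Fin (K + 1) → ρ) j)) =
          V.filter fun i => i ∉ J q := by
        ext i
        simp only [hV, Finset.mem_filter, Fin.forall_fin_succ, Fin.cons_zero, Fin.cons_succ]
        tauto
      rw [he, pow_succ]
      calc 2 ^ K * 2 * (V.filter fun i => i ∉ J q).card
          = 2 ^ K * (2 * (V.filter fun i => i ∉ J q).card) := by ring
        _ ≤ 2 ^ K * V.card := Nat.mul_le_mul_left _ h2
        _ ≤ T.card := hc

end Boosting

/-! ### Few traces off a small set. -/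

section Traces

variable {m : ℕ}

open Classical in
/-- For every weighting of a family of small sets there are a few points off which most of the
family has only a few traces. -/
lemma exists_popular_traces {F : Finset (Finset (Fin m))} {k : ℕ} (hF : NonRedundantLE F k)
    {d : ℕ} (hd : ∀ S ∈ F, S.card ≤ d) (s : ℕ) (w : Finset (Fin m) → ℝ)
    (hw : ∀ S ∈ F, 0 < w S) (hne : F.Nonempty) :
    ∃ J : Finset (Fin m), Jᶜ.card ≤ 2 ^ (s + 2) * d ∧ ∃ P : Finset (Finset (Fin m)),
      P.card ≤ (m + 1) ^ ⌊40 * (k * Real.log (m + 1)) / 2 ^ s⌋₊ ∧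
      9 / 10 * ∑ S ∈ F, w S ≤ ∑ S ∈ F with S ∩ J ∈ P, w S := by
  set W := ∑ S ∈ F, w S with hW
  have hWpos : 0 < W := Finset.sum_pos hw hne
  let μ : F → ℝ := fun S => w S / W
  have hμ : ∀ ω, 0 ≤ μ ω := fun ω => div_nonneg (hw ω ω.2).le hWpos.le
  have hμ1 : ∑ ω, μ ω = 1 := by
    rw [← Finset.sum_div, Finset.sum_coe_sort F w]
    exact div_self hWpos.ne'
  have hmass : ∀ P : Finset (Fin m) → Prop, mass μ (fun ω => P ω) = (∑ S ∈ F with P S, w S) / W := by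
    intro P
    rw [mass, Finset.sum_filter, Finset.sum_div, ← Finset.sum_coe_sort F]
    refine Finset.sum_congr rfl fun ω _ => ?_
    split_ifs <;> simp [μ]
  -- J collects the rare points; the others are few because the expected size of a random member is
  -- at most d.
  let J : Finset (Fin m) := Finset.univ.filter fun i =>
    mass μ (fun ω => i ∈ (ω : Finset (Fin m))) ≤ 1 / 2 ^ (s + 2)
  have hsum : ∑ i, mass μ (fun ω => i ∈ (ω : Finset (Fin m))) ≤ d := by
    unfold mass
    rw [Finset.sum_comm]
    have hswap : ∀ ω : F, ∑ i, (if i ∈ (ω : Finset (Fin m)) then μ ω else 0) =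
        ((ω : Finset (Fin m)).card : ℝ) * μ ω := fun ω => by simp
    calc _ = ∑ ω : F, ((ω : Finset (Fin m)).card : ℝ) * μ ω := by
          refine Finset.sum_congr rfl fun ω _ => ?_
          rw [← hswap]
          exact Finset.sum_congr rfl fun i _ => by congr
      _ ≤ ∑ ω : F, (d : ℝ) * μ ω := by
          refine Finset.sum_le_sum fun ω _ => ?_
          have h1 : ((ω : Finset (Fin m)).card : ℝ) ≤ d := by exact_mod_cast hd ω ω.2
          exact mul_le_mul_of_nonneg_right h1 (hμ ω)
      _ = d := by rw [← Finset.mul_sum, hμ1, mul_one]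
  refine ⟨J, ?_, ?_⟩
  · have h1 : (Jᶜ.card : ℝ) * (1 / 2 ^ (s + 2)) ≤ d := by
      calc (Jᶜ.card : ℝ) * (1 / 2 ^ (s + 2)) = ∑ _i ∈ Jᶜ, (1 : ℝ) / 2 ^ (s + 2) := by
            rw [Finset.sum_const, nsmul_eq_mul]
        _ ≤ ∑ i ∈ Jᶜ, mass μ (fun ω => i ∈ (ω : Finset (Fin m))) := by
            refine Finset.sum_le_sum fun i hi => ?_
            simp only [J, Finset.mem_compl, Finset.mem_filter, Finset.mem_univ, true_and] at hi
            exact (not_le.1 hi).le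
        _ ≤ ∑ i, mass μ (fun ω => i ∈ (ω : Finset (Fin m))) :=
            Finset.sum_le_sum_of_subset_of_nonneg (Finset.subset_univ _)
              fun i _ _ => mass_nonneg hμ _
        _ ≤ d := hsum
    rw [mul_one_div, div_le_iff₀ (by positivity)] at h1
    have h2 : (Jᶜ.card : ℝ) ≤ ((2 ^ (s + 2) * d : ℕ) : ℝ) := by
      push_cast
      linarith
    exact_mod_cast h2
  · obtain ⟨F', hsub, hcl, hcard⟩ := (hF.inter J).exists_unionClosed
    obtain ⟨P, hP, hPm⟩ := exists_list_of_unionClosed (μ := μ)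
      (f := fun ω : F => (ω : Finset (Fin m)) ∩ J) hcl hμ hμ1
      (fun ω => hsub (Finset.mem_image_of_mem (· ∩ J) ω.2)) s (by
        intro i
        by_cases hi : i ∈ J
        · refine le_trans (mass_mono hμ fun ω h => (Finset.mem_inter.1 h).1) ?_
          exact (Finset.mem_filter.1 hi).2
        · have : mass μ (fun ω => i ∈ (ω : Finset (Fin m)) ∩ J) = 0 := by
            unfold mass
            refine Finset.sum_eq_zero fun ω _ => ?_
            simp [hi]
          rw [this]
          positivity)
    refine ⟨P, hP.trans (Nat.pow_le_pow_right (by omega) (Nat.floor_le_floor ?_)), ?_⟩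
    · rw [Fintype.card_fin] at hcard
      have hpos : 0 < F'.card := by
        obtain ⟨S, hS⟩ := hne
        exact Finset.card_pos.2 ⟨_, hsub (Finset.mem_image_of_mem (· ∩ J) hS)⟩
      have h1 : Real.log F'.card ≤ k * Real.log (m + 1) := by
        rw [← Real.log_pow]
        refine Real.log_le_log (by exact_mod_cast hpos) ?_
        exact_mod_cast hcard
      gcongr
    · rw [hmass (fun S => S ∩ J ∈ P), le_div_iff₀ hWpos] at hPm
      exact hPm.trans (le_of_eq (by congr!))

open Classical in
/-- Off a small set of points, a family of small sets has only a few traces. -/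
theorem NonRedundantLE.exists_few_traces {F : Finset (Finset (Fin m))} {k : ℕ}
    (hF : NonRedundantLE F k) (hm : 1 ≤ m) {d : ℕ} (hd : ∀ S ∈ F, S.card ≤ d) (s K : ℕ)
    (hK : m < 2 ^ K) :
    ∃ I : Finset (Fin m), I.card ≤ 3 * 2 ^ (s + 2) * d ∧
      (F.image (· \ I)).card ≤
        (12 * m * (m + 1) ^ ⌊40 * (k * Real.log (m + 1)) / 2 ^ s⌋₊) ^ K := by
  rcases F.eq_empty_or_nonempty with rfl | hne
  · exact ⟨∅, by simp, by simp⟩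
  set M := (m + 1) ^ ⌊40 * (k * Real.log (m + 1)) / 2 ^ s⌋₊ with hM
  let τ := {x : Finset (Fin m) × Finset (Finset (Fin m)) //
    x.1ᶜ.card ≤ 2 ^ (s + 2) * d ∧ x.2.card ≤ M}
  have hFcard : F.card ≤ 2 ^ m := by
    refine (Finset.card_le_univ F).trans ?_
    simp
  obtain ⟨x, hx⟩ := exists_boost (τ := τ) F (fun x S => S ∩ x.1.1 ∈ x.1.2) (by
    intro w hw
    obtain ⟨J, hJ, P, hP, h⟩ := exists_popular_traces hF hd s w hw hne
    refine ⟨⟨(J, P), hJ, hP⟩, ?_⟩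
    convert h) hm hFcard
  let J : Fin (12 * m) → Finset (Fin m) := fun r => (x r).1.1
  let P : Fin (12 * m) → Finset (Finset (Fin m)) := fun r => (x r).1.2
  -- Double counting bounds I. A point off I is missed by at most 4m of the J r, fewer than half of
  -- the 9m indices that serve a given S.
  let I : Finset (Fin m) := Finset.univ.filter fun i =>
    4 * m < (Finset.univ.filter fun r => i ∉ J r).card
  refine ⟨I, ?_, ?_⟩
  · have h1 : I.card * (4 * m) ≤ 12 * m * (2 ^ (s + 2) * d) := by
      calc I.card * (4 * m) = ∑ _i ∈ I, 4 * m := by rw [Finset.sum_const, smul_eq_mul]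
        _ ≤ ∑ i ∈ I, (Finset.univ.filter fun r => i ∉ J r).card :=
            Finset.sum_le_sum fun i hi => (Finset.mem_filter.1 hi).2.le
        _ ≤ ∑ i, (Finset.univ.filter fun r => i ∉ J r).card :=
            Finset.sum_le_sum_of_subset (Finset.subset_univ _)
        _ = ∑ r, (J r)ᶜ.card := by
            simp only [Finset.card_filter]
            rw [Finset.sum_comm]
            refine Finset.sum_congr rfl fun r _ => ?_
            rw [← Finset.card_filter]
            congr 1
            ext i
            simp
        _ ≤ ∑ _r : Fin (12 * m), 2 ^ (s + 2) * d := Finset.sum_le_sum fun r _ => (x r).2.1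
        _ = 12 * m * (2 ^ (s + 2) * d) := by simp
    have h2 : 4 * m * I.card ≤ 4 * m * (3 * 2 ^ (s + 2) * d) := by nlinarith
    exact Nat.le_of_mul_le_mul_left h2 (by omega)
  · let Φ : (Fin K → (Σ _ : Fin (12 * m), Finset (Fin m))) → Finset (Fin m) := fun c =>
      (Finset.univ.biUnion fun j => (c j).2) \ I
    have hsub : F.image (· \ I) ⊆
        (Fintype.piFinset fun _ : Fin K => Finset.univ.sigma P).image Φ := by
      intro T hT
      obtain ⟨S, hS, rfl⟩ := Finset.mem_image.1 hT
      set Q := Finset.univ.filter fun r => S ∩ J r ∈ P r with hQ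
      have hQc : 9 * m ≤ Q.card := by
        convert hx S hS
      obtain ⟨r, hr, hc⟩ := exists_cover Q (Finset.card_pos.1 (by omega)) J (S \ I) (by
        intro i hi
        have hiI : i ∉ I := (Finset.mem_sdiff.1 hi).2
        simp only [I, Finset.mem_filter, Finset.mem_univ, true_and, not_lt] at hiI
        have : (Q.filter fun r => i ∉ J r).card ≤
            (Finset.univ.filter fun r => i ∉ J r).card :=
          Finset.card_le_card (Finset.filter_subset_filter _ (Finset.subset_univ _))
        omega) K
      have hcov : ∀ i ∈ S \ I, ∃ j, i ∈ J (r j) := by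
        intro i hi
        by_contra hcon
        push Not at hcon
        have h1 : 0 < ((S \ I).filter fun i => ∀ j, i ∉ J (r j)).card :=
          Finset.card_pos.2 ⟨i, Finset.mem_filter.2 ⟨hi, hcon⟩⟩
        have h2 : (S \ I).card ≤ m := by
          refine (Finset.card_le_univ _).trans ?_
          simp
        have h3 := Nat.mul_le_mul_left (2 ^ K) h1
        omega
      refine Finset.mem_image.2 ⟨fun j => ⟨r j, S ∩ J (r j)⟩, ?_, ?_⟩
      · refine Fintype.mem_piFinset.2 fun j => Finset.mem_sigma.2 ⟨Finset.mem_univ _, ?_⟩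
        exact (Finset.mem_filter.1 (hr j)).2
      · ext i
        simp only [Φ, Finset.mem_sdiff, Finset.mem_biUnion, Finset.mem_univ, true_and,
          Finset.mem_inter]
        constructor
        · rintro ⟨⟨j, hi, -⟩, hI⟩
          exact ⟨hi, hI⟩
        · rintro ⟨hi, hI⟩
          obtain ⟨j, hj⟩ := hcov i (Finset.mem_sdiff.2 ⟨hi, hI⟩)
          exact ⟨⟨j, hi, hj⟩, hI⟩
    refine (Finset.card_le_card hsub).trans (Finset.card_image_le.trans ?_)
    rw [Fintype.card_piFinset]
    simp only [Finset.prod_const, Finset.card_univ, Fintype.card_fin]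
    refine Nat.pow_le_pow_left ?_ K
    rw [Finset.card_sigma]
    calc ∑ r, (P r).card ≤ ∑ _r : Fin (12 * m), M := Finset.sum_le_sum fun r _ => (x r).2.2
      _ = 12 * m * M := by simp

end Traces

/-! ### The union of the small sets. -/

section Support

variable {α : Type*} [DecidableEq α]

/-- A relation with out-degrees at most `d` has a large independent set. -/
lemma exists_independent (S : α → Finset α) {d : ℕ} (V : Finset α)
    (hmem : ∀ i ∈ V, i ∈ S i) (hd : ∀ i ∈ V, (S i).card ≤ d) :
    ∃ I ⊆ V, (∀ i ∈ I, S i ∩ I = {i}) ∧ V.card ≤ 2 * d * I.card := by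
  induction V using Finset.strongInduction with
  | H V ih =>
    rcases V.eq_empty_or_nonempty with rfl | hne
    · exact ⟨∅, by simp, by simp, by simp⟩
    -- Greedy choice: the least in-degree is at most the average out-degree, so v and its neighbours
    -- in both directions number at most 2d and can be deleted.
    obtain ⟨v, hv, hvm⟩ := V.exists_min_image (fun v => (V.filter fun u => v ∈ S u).card) hne
    have hin : (V.filter fun u => v ∈ S u).card ≤ d := by
      have h1 : V.card * (V.filter fun u => v ∈ S u).card ≤ V.card * d := by
        calc V.card * (V.filter fun u => v ∈ S u).card
            = ∑ _x ∈ V, (V.filter fun u => v ∈ S u).card := by rw [Finset.sum_const, smul_eq_mul]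
          _ ≤ ∑ x ∈ V, (V.filter fun u => x ∈ S u).card := Finset.sum_le_sum hvm
          _ = ∑ u ∈ V, (V.filter fun x => x ∈ S u).card := by
              simp only [Finset.card_filter]
              rw [Finset.sum_comm]
          _ ≤ ∑ _u ∈ V, d := Finset.sum_le_sum fun u hu =>
              (Finset.card_le_card fun x hx => (Finset.mem_filter.1 hx).2).trans (hd u hu)
          _ = V.card * d := by rw [Finset.sum_const, smul_eq_mul]
      exact Nat.le_of_mul_le_mul_left h1 hne.card_pos
    set N := S v ∪ V.filter fun u => v ∈ S u with hN
    have hvN : v ∈ N := Finset.mem_union_left _ (hmem v hv)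
    obtain ⟨I, hI, hind, hcard⟩ := ih (V \ N)
      (Finset.ssubset_iff_subset_ne.2 ⟨Finset.sdiff_subset, fun h => by
        have : v ∈ V \ N := by rw [h]; exact hv
        exact (Finset.mem_sdiff.1 this).2 hvN⟩)
      (fun i hi => hmem i (Finset.mem_sdiff.1 hi).1)
      (fun i hi => hd i (Finset.mem_sdiff.1 hi).1)
    have hvI : v ∉ I := fun h => (Finset.mem_sdiff.1 (hI h)).2 hvN
    refine ⟨insert v I, ?_, ?_, ?_⟩
    · exact Finset.insert_subset hv (hI.trans Finset.sdiff_subset)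
    · intro i hi
      rcases Finset.mem_insert.1 hi with rfl | hi
      · ext x
        simp only [Finset.mem_inter, Finset.mem_insert, Finset.mem_singleton]
        constructor
        · rintro ⟨h1, h2 | h2⟩
          · exact h2
          · exact absurd (Finset.mem_union_left _ h1) (Finset.mem_sdiff.1 (hI h2)).2
        · rintro rfl
          exact ⟨hmem x hv, Or.inl rfl⟩
      · rw [Finset.inter_insert_of_notMem, hind i hi]
        intro hvi
        obtain ⟨h1, h2⟩ := Finset.mem_sdiff.1 (hI hi)
        exact h2 (Finset.mem_union_right _ (Finset.mem_filter.2 ⟨h1, hvi⟩))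
    · rw [Finset.card_insert_of_notMem hvI]
      have h1 : V.card ≤ (V \ N).card + N.card := by
        have : V ⊆ (V \ N) ∪ N := by
          intro x hx
          rw [Finset.sdiff_union_self_eq_union]
          exact Finset.mem_union_left _ hx
        exact (Finset.card_le_card this).trans (Finset.card_union_le _ _)
      have h2 : N.card ≤ d + d := (Finset.card_union_le _ _).trans (Nat.add_le_add (hd v hv) hin)
      calc V.card ≤ 2 * d * I.card + (d + d) := by omega
        _ = 2 * d * (I.card + 1) := by ring

/-- The small sets of a family cover few points. -/
lemma NonRedundantLE.card_biUnion_le {F : Finset (Finset α)} {k : ℕ} (h : NonRedundantLE F k)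
    {d : ℕ} (hd : ∀ S ∈ F, S.card ≤ d) : (F.biUnion id).card ≤ 2 * d * k := by
  have hch : ∀ i ∈ F.biUnion id, ∃ S ∈ F, i ∈ S := fun i hi => by simpa using hi
  choose! S hS hiS using hch
  obtain ⟨I, hI, hind, hcard⟩ := exists_independent S (F.biUnion id) hiS fun i hi => hd _ (hS i hi)
  exact hcard.trans (Nat.mul_le_mul_left _ (h I fun i hi => ⟨S i, hS i (hI hi), hind i hi⟩))

end Support

/-! ### Concentration for a uniform random subset. -/

section Chernoff

variable {m : ℕ}

/-- The exponential moment of a uniform B factorises over points, and cosh l ≤ exp(l²/2). -/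
lemma sum_exp_le (T : Finset (Fin m)) (l : ℝ) :
    ∑ B : Finset (Fin m), Real.exp (l * (2 * (T ∩ B).card - T.card)) ≤
      2 ^ m * Real.exp (l ^ 2 * T.card / 2) := by
  have hterm : ∀ B : Finset (Fin m), Real.exp (l * (2 * (T ∩ B).card - T.card)) =
      (∏ i ∈ B, if i ∈ T then Real.exp l else 1) *
        ∏ i ∈ Finset.univ \ B, if i ∈ T then Real.exp (-l) else 1 := by
    intro B
    rw [Finset.prod_ite_mem, Finset.prod_ite_mem, Finset.prod_const, Finset.prod_const,
      ← Real.exp_nat_mul, ← Real.exp_nat_mul, ← Real.exp_add]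
    congr 1
    have h1 : (Finset.univ \ B) ∩ T = T \ B := by
      ext i
      simp [and_comm]
    have h2 := Finset.card_inter_add_card_sdiff T B
    rw [h1, Finset.inter_comm B T, ← h2]
    push_cast
    ring
  have hsum : ∑ B : Finset (Fin m), Real.exp (l * (2 * (T ∩ B).card - T.card)) =
      ∏ i : Fin m, ((if i ∈ T then Real.exp l else 1) + if i ∈ T then Real.exp (-l) else 1) := by
    rw [Finset.prod_add, Finset.powerset_univ]
    exact Finset.sum_congr rfl fun B _ => hterm B
  rw [hsum]
  calc _ ≤ ∏ i : Fin m, 2 * (if i ∈ T then Real.exp (l ^ 2 / 2) else 1) := by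
        refine Finset.prod_le_prod (fun i _ => by split_ifs <;> positivity) fun i _ => ?_
        split_ifs
        · have := Real.cosh_le_exp_half_sq l
          rw [Real.cosh_eq] at this
          linarith
        · norm_num
    _ = _ := by
        rw [Finset.prod_mul_distrib, Finset.prod_const, Finset.prod_ite_mem, Finset.prod_const,
          ← Real.exp_nat_mul]
        simp only [Finset.card_univ, Fintype.card_fin, Finset.univ_inter]
        congr 2
        ring

-- Markov's inequality for the exponential moment.
open Classical in
lemma card_tail_le (T : Finset (Fin m)) (l : ℝ) {x : ℝ} :
    ((Finset.univ.filter fun B : Finset (Fin m) =>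
      x < l * (2 * (T ∩ B).card - T.card)).card : ℝ) ≤
      2 ^ m * Real.exp (l ^ 2 * T.card / 2 - x) := by
  have h1 : ((Finset.univ.filter fun B : Finset (Fin m) =>
      x < l * (2 * (T ∩ B).card - T.card)).card : ℝ) * Real.exp x ≤
      ∑ B : Finset (Fin m), Real.exp (l * (2 * (T ∩ B).card - T.card)) := by
    rw [← nsmul_eq_mul, ← Finset.sum_const]
    refine (Finset.sum_le_sum fun B hB => ?_).trans (Finset.sum_le_sum_of_subset_of_nonneg
      (Finset.filter_subset _ _) fun _ _ _ => (Real.exp_pos _).le)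
    exact Real.exp_le_exp.2 (Finset.mem_filter.1 hB).2.le
  have h2 := h1.trans (sum_exp_le T l)
  rw [Real.exp_sub, mul_div_assoc', le_div_iff₀ (Real.exp_pos x)]
  exact h2

open Classical in
/-- Most subsets contain nearly half of `T`. -/
lemma card_deviation_le (T : Finset (Fin m)) {η D : ℝ} (hη : 0 < η) (hT : (T.card : ℝ) ≤ 2 * D) :
    ((Finset.univ.filter fun B : Finset (Fin m) =>
      η * D < |2 * ((T ∩ B).card : ℝ) - T.card|).card : ℝ) ≤
      2 ^ m * (2 * Real.exp (-(η ^ 2 * D / 4))) := by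
  have hsub : (Finset.univ.filter fun B : Finset (Fin m) =>
      η * D < |2 * ((T ∩ B).card : ℝ) - T.card|) ⊆
      (Finset.univ.filter fun B : Finset (Fin m) =>
        η ^ 2 * D / 2 < (η / 2) * (2 * (T ∩ B).card - T.card)) ∪
      (Finset.univ.filter fun B : Finset (Fin m) =>
        η ^ 2 * D / 2 < (-η / 2) * (2 * (T ∩ B).card - T.card)) := by
    intro B hB
    have h := (Finset.mem_filter.1 hB).2
    simp only [Finset.mem_union, Finset.mem_filter, Finset.mem_univ, true_and]
    rcases lt_abs.1 h with h | h
    · left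
      nlinarith
    · right
      nlinarith
  -- With tilt ±η/2 and |T| ≤ 2D the exponent is at most η²D/4 - η²D/2.
  have h1 := card_tail_le T (η / 2) (x := η ^ 2 * D / 2)
  have h2 := card_tail_le T (-η / 2) (x := η ^ 2 * D / 2)
  have h3 : ∀ l : ℝ, l ^ 2 = η ^ 2 / 4 → Real.exp (l ^ 2 * T.card / 2 - η ^ 2 * D / 2) ≤
      Real.exp (-(η ^ 2 * D / 4)) := by
    intro l hl
    rw [hl]
    refine Real.exp_le_exp.2 ?_
    nlinarith [sq_nonneg η]
  have h4 := h3 (η / 2) (by ring)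
  have h5 := h3 (-η / 2) (by ring)
  calc _ ≤ _ := Nat.cast_le.2 ((Finset.card_le_card hsub).trans (Finset.card_union_le _ _))
    _ ≤ 2 ^ m * Real.exp (-(η ^ 2 * D / 4)) + 2 ^ m * Real.exp (-(η ^ 2 * D / 4)) := by
        push_cast
        refine add_le_add (h1.trans ?_) (h2.trans ?_) <;> gcongr
    _ = _ := by ring

end Chernoff

/-! ### Discarding half of the points. -/

section Halving

variable {m : ℕ}

lemma two_pow_le_exp (n : ℕ) : (2 : ℝ) ^ n ≤ Real.exp n := by
  have h : (2 : ℝ) ≤ Real.exp 1 := by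
    have := Real.add_one_le_exp (1 : ℝ)
    linarith
  calc (2 : ℝ) ^ n ≤ Real.exp 1 ^ n := by gcongr
    _ = Real.exp n := by rw [← Real.exp_nat_mul, mul_one]

/-- The number of traces at scale 2^j is kept below the inverse square root of the Chernoff factor
exp(-η²2^j/4), with an exceptional set whose size bound does not depend on j. -/
lemma NonRedundantLE.exists_few_traces_exp {F : Finset (Finset (Fin m))} {k : ℕ}
    (hF : NonRedundantLE F k) (hm : 1 ≤ m) {K : ℕ} (hK : m < 2 ^ K) {η : ℝ} (hη : 0 < η) (j : ℕ)
    (hd : ∀ S ∈ F, S.card ≤ 2 * 2 ^ j) (hj : 80 * (K : ℝ) ^ 2 ≤ η ^ 2 * 2 ^ j) :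
    ∃ I : Finset (Fin m), (I.card : ℝ) ≤ 32000 * k * K ^ 3 / η ^ 2 ∧
      ((F.image (· \ I)).card : ℝ) ≤ Real.exp (η ^ 2 * 2 ^ j / 8) := by
  have hK1 : 1 ≤ K := by
    rcases Nat.eq_zero_or_pos K with rfl | h
    · omega
    · exact h
  have hK1' : (1 : ℝ) ≤ K := by exact_mod_cast hK1
  have hk0 : (0 : ℝ) ≤ k := Nat.cast_nonneg k
  have hmK : ((m : ℝ) + 1) ≤ 2 ^ K := by exact_mod_cast hK
  -- At large scales the bound (m + 1)^k ≤ 2^{kK} on the whole family suffices and no point is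
  -- removed.
  rcases le_or_gt (8 * (k * K : ℝ)) (η ^ 2 * 2 ^ j) with hbig | hsmall
  · refine ⟨∅, by rw [Finset.card_empty, Nat.cast_zero]; positivity, ?_⟩
    obtain ⟨F', hsub, -, hcard⟩ := hF.exists_unionClosed
    rw [Fintype.card_fin] at hcard
    calc ((F.image (· \ ∅)).card : ℝ) ≤ ((m + 1) ^ k : ℕ) :=
          Nat.cast_le.2 (Finset.card_image_le.trans ((Finset.card_le_card hsub).trans hcard))
      _ = ((m : ℝ) + 1) ^ k := by push_cast; rfl
      _ ≤ (2 ^ K) ^ k := by gcongr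
      _ = 2 ^ (k * K) := by rw [← pow_mul, mul_comm]
      _ ≤ Real.exp (k * K : ℕ) := two_pow_le_exp _
      _ ≤ _ := by
          refine Real.exp_le_exp.2 ?_
          push_cast
          linarith
  -- The choice 2^s ≥ A makes the list exponent K²g at most η²2^j/16; the other half of η²2^j/8 pays
  -- for K(4 + K) ≤ 5K², by `hj`. That 2^s ≤ 2A + 2 keeps I small.
  · set A : ℝ := 640 * k * K ^ 3 / (η ^ 2 * 2 ^ j) with hA
    have hden : 0 < η ^ 2 * 2 ^ j := by positivity
    have hA0 : 0 ≤ A := by positivity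
    obtain ⟨s', hs1, hs2⟩ := exists_nat_pow_near (le_max_right A 1) (one_lt_two (α := ℝ))
    obtain ⟨s, hs⟩ : ∃ s, s = s' + 1 := ⟨_, rfl⟩
    rw [← hs] at hs2
    have hsA : A ≤ 2 ^ s := (le_max_left _ _).trans hs2.le
    have hsA2 : (2 : ℝ) ^ s ≤ 2 * A + 2 := by
      rw [hs, pow_succ]
      have : max A 1 ≤ A + 1 := max_le (by linarith) (by linarith)
      linarith
    obtain ⟨I, hI, hN⟩ := hF.exists_few_traces hm hd s K hK
    refine ⟨I, ?_, ?_⟩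
    · have h1 : (I.card : ℝ) ≤ 3 * 2 ^ (s + 2) * (2 * 2 ^ j) := by exact_mod_cast hI
      have h2 : A * 2 ^ j = 640 * k * K ^ 3 / η ^ 2 := by
        rw [hA]
        field_simp
      have h3 : (2 : ℝ) ^ j ≤ 8 * (k * K ^ 3) / η ^ 2 := by
        rw [le_div_iff₀ (by positivity)]
        have : (k * K : ℝ) ≤ k * K ^ 3 := by
          gcongr
          exact le_self_pow₀ hK1' (by norm_num)
        linarith
      calc (I.card : ℝ) ≤ 24 * 2 ^ s * 2 ^ j := by rw [pow_add] at h1; linarith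
        _ ≤ 24 * (2 * A + 2) * 2 ^ j := by gcongr
        _ = 48 * (A * 2 ^ j) + 48 * 2 ^ j := by ring
        _ ≤ 48 * (640 * k * K ^ 3 / η ^ 2) + 48 * (8 * (k * K ^ 3) / η ^ 2) := by
            rw [h2]
            gcongr
        _ = 31104 * (k * K ^ 3 / η ^ 2) := by ring
        _ ≤ 32000 * (k * K ^ 3 / η ^ 2) := by
            gcongr
            norm_num
        _ = _ := by ring
    · set g := ⌊40 * (k * Real.log (m + 1)) / 2 ^ s⌋₊ with hg
      have hlog : Real.log (m + 1) ≤ K := by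
        have h1 : (0 : ℝ) < (m : ℝ) + 1 := by positivity
        rw [Real.log_le_iff_le_exp h1]
        exact hmK.trans (two_pow_le_exp K)
      have hlog0 : 0 ≤ Real.log (m + 1) := by
        refine Real.log_nonneg ?_
        have : (0 : ℝ) ≤ m := Nat.cast_nonneg m
        linarith
      have hgle : (g : ℝ) ≤ 40 * (k * K) / 2 ^ s := by
        refine (Nat.floor_le (by positivity)).trans ?_
        gcongr
      have h1 : ((12 * m * (m + 1) ^ g : ℕ) : ℝ) ≤ Real.exp (4 + K + K * g) := by
        push_cast
        have h2 : (12 : ℝ) * m ≤ 2 ^ (4 + K) := by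
          rw [pow_add]
          have : (0 : ℝ) ≤ m := Nat.cast_nonneg m
          nlinarith
        calc (12 : ℝ) * m * (m + 1) ^ g ≤ 2 ^ (4 + K) * (2 ^ K) ^ g := by gcongr
          _ = 2 ^ (4 + K + K * g) := by rw [← pow_mul, ← pow_add]
          _ ≤ Real.exp (4 + K + K * g : ℕ) := two_pow_le_exp _
          _ = _ := by push_cast; rfl
      calc ((F.image (· \ I)).card : ℝ) ≤ (((12 * m * (m + 1) ^ g) ^ K : ℕ) : ℝ) :=
            Nat.cast_le.2 hN
        _ = ((12 * m * (m + 1) ^ g : ℕ) : ℝ) ^ K := by push_cast; rfl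
        _ ≤ Real.exp (4 + K + K * g) ^ K := by gcongr
        _ = Real.exp (K * (4 + K + K * g)) := by rw [← Real.exp_nat_mul]
        _ ≤ _ := by
            refine Real.exp_le_exp.2 ?_
            have h3 : (K : ℝ) ^ 2 * g ≤ η ^ 2 * 2 ^ j / 16 := by
              calc (K : ℝ) ^ 2 * g ≤ K ^ 2 * (40 * (k * K) / 2 ^ s) := by gcongr
                _ = 40 * (k : ℝ) * (K : ℝ) ^ 3 / 2 ^ s := by ring
                _ ≤ _ := by
                    rw [div_le_iff₀ (by positivity)]
                    rw [hA, div_le_iff₀ hden] at hsA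
                    linarith
            nlinarith

open Classical in
/-- Half of the points can be discarded so that all sets of the family are nearly preserved. -/
theorem NonRedundantLE.exists_halving {F : Finset (Finset (Fin m))} {k : ℕ}
    (hF : NonRedundantLE F k) (hm : 1 ≤ m) {K : ℕ} (hK : m < 2 ^ K) {η : ℝ} (hη : 0 < η)
    (hη1 : η ≤ 1) (C : Finset (Fin m)) (hC : ∀ S ∈ F, S ⊆ C) :
    ∃ I B : Finset (Fin m), (I.card : ℝ) ≤ 33000 * k * K ^ 4 / η ^ 2 ∧ Disjoint I B ∧
      2 * B.card ≤ C.card ∧ ∀ S ∈ F,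
        |((S ∩ I).card : ℝ) + 2 * (S ∩ B).card - S.card| ≤ η * S.card := by
  have hK1 : 1 ≤ K := by
    rcases Nat.eq_zero_or_pos K with rfl | h
    · omega
    · exact h
  have hK1' : (1 : ℝ) ≤ K := by exact_mod_cast hK1
  have hk0 : (0 : ℝ) ≤ k := Nat.cast_nonneg k
  let Fj : ℕ → Finset (Finset (Fin m)) := fun j =>
    F.filter fun S => 2 ^ j ≤ S.card ∧ S.card ≤ 2 * 2 ^ j
  have hIj : ∀ j, ∃ I : Finset (Fin m), (I.card : ℝ) ≤ 32000 * k * K ^ 3 / η ^ 2 ∧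
      (80 * (K : ℝ) ^ 2 ≤ η ^ 2 * 2 ^ j →
        (((Fj j).image (· \ I)).card : ℝ) ≤ Real.exp (η ^ 2 * 2 ^ j / 8)) := by
    intro j
    by_cases hj : 80 * (K : ℝ) ^ 2 ≤ η ^ 2 * 2 ^ j
    · obtain ⟨I, h1, h2⟩ := (hF.mono (G := Fj j) (Finset.filter_subset _ _)).exists_few_traces_exp
        hm hK hη j (fun S hS => (Finset.mem_filter.1 hS).2.2) hj
      exact ⟨I, h1, fun _ => h2⟩
    · exact ⟨∅, by rw [Finset.card_empty, Nat.cast_zero]; positivity, fun h => absurd h hj⟩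
  choose Ij hIc hIt using hIj
  -- Where η²2^j < 80K² concentration is too weak. Sets of such scales have size at most d₀, and
  -- their small union is kept whole.
  set d₀ : ℕ := ⌈160 * (K : ℝ) ^ 2 / η ^ 2⌉₊ with hd₀
  let I₀ : Finset (Fin m) := (F.filter fun S => S.card ≤ d₀).biUnion id
  have hI₀ : (I₀.card : ℝ) ≤ 322 * (k * K ^ 2 / η ^ 2) := by
    have h1 := (hF.mono (Finset.filter_subset (fun S => S.card ≤ d₀) F)).card_biUnion_le
      (fun S hS => (Finset.mem_filter.1 hS).2)
    have h2 : (I₀.card : ℝ) ≤ 2 * d₀ * k := by exact_mod_cast h1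
    have h3 : (d₀ : ℝ) ≤ 160 * (K : ℝ) ^ 2 / η ^ 2 + 1 :=
      (Nat.ceil_lt_add_one (by positivity)).le
    have h4 : (1 : ℝ) ≤ K ^ 2 / η ^ 2 := by
      rw [le_div_iff₀ (by positivity)]
      nlinarith
    calc (I₀.card : ℝ) ≤ 2 * (160 * (K : ℝ) ^ 2 / η ^ 2 + K ^ 2 / η ^ 2) * k := by
          refine h2.trans ?_
          gcongr
          linarith
      _ = _ := by ring
  set I : Finset (Fin m) := I₀ ∪ (Finset.range K).biUnion Ij with hI
  have hIcard : (I.card : ℝ) ≤ 33000 * k * K ^ 4 / η ^ 2 := by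
    have h1 : (((Finset.range K).biUnion Ij).card : ℝ) ≤ K * (32000 * k * K ^ 3 / η ^ 2) := by
      calc (((Finset.range K).biUnion Ij).card : ℝ) ≤ ((∑ j ∈ Finset.range K, (Ij j).card : ℕ) : ℝ) :=
            Nat.cast_le.2 Finset.card_biUnion_le
        _ = ∑ j ∈ Finset.range K, ((Ij j).card : ℝ) := by push_cast; rfl
        _ ≤ ∑ _j ∈ Finset.range K, 32000 * k * K ^ 3 / η ^ 2 :=
            Finset.sum_le_sum fun j _ => hIc j
        _ = _ := by rw [Finset.sum_const, Finset.card_range, nsmul_eq_mul]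
    have h2 : (I.card : ℝ) ≤ I₀.card + ((Finset.range K).biUnion Ij).card := by
      exact_mod_cast Finset.card_union_le _ _
    have h3 : (k * K ^ 2 / η ^ 2 : ℝ) ≤ k * K ^ 4 / η ^ 2 := by
      gcongr
      norm_num
    have h4 : (0 : ℝ) ≤ k * K ^ 4 / η ^ 2 := by positivity
    have h5 : K * (32000 * k * K ^ 3 / η ^ 2 : ℝ) = 32000 * (k * K ^ 4 / η ^ 2) := by ring
    have h6 : 33000 * k * K ^ 4 / η ^ 2 = 33000 * (k * K ^ 4 / η ^ 2 : ℝ) := by ring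
    rw [h6]
    linarith
  -- the colourings that are bad for some trace
  let good : Finset ℕ := (Finset.range K).filter fun j => 80 * (K : ℝ) ^ 2 ≤ η ^ 2 * 2 ^ j
  let bad : Finset (Finset (Fin m)) := good.biUnion fun j =>
    ((Fj j).image (· \ I)).biUnion fun T => Finset.univ.filter fun B : Finset (Fin m) =>
      η * 2 ^ j < |2 * ((T ∩ B).card : ℝ) - T.card|
  -- Union bound: exp(η²2^j/8) traces, each bad with probability 2exp(-η²2^j/4), leave at most
  -- 2exp(-10K²) per scale, with at most K scales.
  have hbad : (bad.card : ℝ) < 2 ^ m := by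
    have hTle : ∀ j ∈ good, (((((Fj j).image (· \ I)).biUnion fun T =>
        Finset.univ.filter fun B : Finset (Fin m) =>
          η * 2 ^ j < |2 * ((T ∩ B).card : ℝ) - T.card|).card : ℕ) : ℝ) ≤
        2 ^ m * (2 * Real.exp (-(10 * (K : ℝ) ^ 2))) := by
      intro j hj
      obtain ⟨hjK, hj80⟩ := Finset.mem_filter.1 hj
      have hsubI : Ij j ⊆ I := fun x hx =>
        Finset.mem_union_right _ (Finset.mem_biUnion.2 ⟨j, hjK, hx⟩)
      have hcount : (((Fj j).image (· \ I)).card : ℝ) ≤ Real.exp (η ^ 2 * 2 ^ j / 8) := by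
        refine le_trans ?_ (hIt j hj80)
        have : (Fj j).image (· \ I) = ((Fj j).image (· \ Ij j)).image (· \ I) := by
          rw [Finset.image_image]
          refine Finset.image_congr fun S _ => ?_
          simp only [Function.comp_apply]
          rw [sdiff_sdiff_left, Finset.sup_eq_union, Finset.union_eq_right.2 hsubI]
        rw [this]
        exact Nat.cast_le.2 Finset.card_image_le
      calc _ ≤ ((∑ T ∈ (Fj j).image (· \ I), (Finset.univ.filter fun B : Finset (Fin m) =>
              η * 2 ^ j < |2 * ((T ∩ B).card : ℝ) - T.card|).card : ℕ) : ℝ) :=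
            Nat.cast_le.2 Finset.card_biUnion_le
        _ = ∑ T ∈ (Fj j).image (· \ I), ((Finset.univ.filter fun B : Finset (Fin m) =>
              η * 2 ^ j < |2 * ((T ∩ B).card : ℝ) - T.card|).card : ℝ) := by push_cast; rfl
        _ ≤ ∑ _T ∈ (Fj j).image (· \ I), 2 ^ m * (2 * Real.exp (-(η ^ 2 * 2 ^ j / 4))) := by
            refine Finset.sum_le_sum fun T hT => ?_
            refine card_deviation_le T hη ?_
            obtain ⟨S, hS, rfl⟩ := Finset.mem_image.1 hT
            have h1 := (Finset.card_le_card (Finset.sdiff_subset (s := S) (t := I))).trans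
              (Finset.mem_filter.1 hS).2.2
            exact_mod_cast h1
        _ = (((Fj j).image (· \ I)).card : ℝ) *
              (2 ^ m * (2 * Real.exp (-(η ^ 2 * 2 ^ j / 4)))) := by
            rw [Finset.sum_const, nsmul_eq_mul]
        _ ≤ Real.exp (η ^ 2 * 2 ^ j / 8) *
              (2 ^ m * (2 * Real.exp (-(η ^ 2 * 2 ^ j / 4)))) := by gcongr
        _ = 2 ^ m * (2 * Real.exp (-(η ^ 2 * 2 ^ j / 8))) := by
            have : Real.exp (-(η ^ 2 * 2 ^ j / 8)) =
                Real.exp (η ^ 2 * 2 ^ j / 8) * Real.exp (-(η ^ 2 * 2 ^ j / 4)) := by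
              rw [← Real.exp_add]
              congr 1
              ring
            rw [this]
            ring
        _ ≤ _ := by
            gcongr
            linarith
    have hsmall : (K : ℝ) * (2 * Real.exp (-(10 * (K : ℝ) ^ 2))) < 1 := by
      rw [Real.exp_neg, ← mul_assoc, ← div_eq_mul_inv, div_lt_one (Real.exp_pos _)]
      have := Real.add_one_le_exp (10 * (K : ℝ) ^ 2)
      nlinarith
    calc (bad.card : ℝ) ≤ ((∑ j ∈ good, (((Fj j).image (· \ I)).biUnion fun T =>
            Finset.univ.filter fun B : Finset (Fin m) =>
              η * 2 ^ j < |2 * ((T ∩ B).card : ℝ) - T.card|).card : ℕ) : ℝ) :=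
          Nat.cast_le.2 Finset.card_biUnion_le
      _ = ∑ j ∈ good, ((((Fj j).image (· \ I)).biUnion fun T =>
            Finset.univ.filter fun B : Finset (Fin m) =>
              η * 2 ^ j < |2 * ((T ∩ B).card : ℝ) - T.card|).card : ℝ) := by push_cast; rfl
      _ ≤ ∑ _j ∈ good, 2 ^ m * (2 * Real.exp (-(10 * (K : ℝ) ^ 2))) := Finset.sum_le_sum hTle
      _ = (good.card : ℝ) * (2 ^ m * (2 * Real.exp (-(10 * (K : ℝ) ^ 2)))) := by
          rw [Finset.sum_const, nsmul_eq_mul]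
      _ ≤ K * (2 ^ m * (2 * Real.exp (-(10 * (K : ℝ) ^ 2)))) := by
          gcongr
          refine (Finset.card_le_card (Finset.filter_subset _ _)).trans ?_
          simp
      _ = 2 ^ m * (K * (2 * Real.exp (-(10 * (K : ℝ) ^ 2)))) := by ring
      _ < 2 ^ m * 1 := by gcongr
      _ = 2 ^ m := mul_one _
  obtain ⟨B₀, hB₀⟩ : ∃ B₀, B₀ ∉ bad := by
    by_contra hcon
    push Not at hcon
    have h1 : bad = Finset.univ := Finset.eq_univ_of_forall hcon
    rw [h1] at hbad
    simp at hbad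
  have hdev : ∀ S ∈ F, |2 * (((S \ I) ∩ B₀).card : ℝ) - (S \ I).card| ≤ η * S.card := by
    intro S hS
    rcases Nat.eq_zero_or_pos S.card with h0 | hpos
    · have : S = ∅ := Finset.card_eq_zero.1 h0
      simp [this]
    set j := Nat.log 2 S.card with hj
    have hj1 : 2 ^ j ≤ S.card := Nat.pow_log_le_self 2 hpos.ne'
    have hj2 : S.card < 2 * 2 ^ j := by
      have := Nat.lt_pow_succ_log_self (b := 2) (by norm_num) S.card
      rw [← hj] at this
      rw [pow_succ] at this
      omega
    have hjK : j < K := by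
      have h1 : S.card ≤ m := by
        refine (Finset.card_le_univ S).trans ?_
        simp
      exact (Nat.pow_lt_pow_iff_right (by norm_num)).1 (hj1.trans_lt (h1.trans_lt hK))
    have hj1' : (2 : ℝ) ^ j ≤ S.card := by exact_mod_cast hj1
    have hj2' : (S.card : ℝ) < 2 * 2 ^ j := by exact_mod_cast hj2
    by_cases h80 : 80 * (K : ℝ) ^ 2 ≤ η ^ 2 * 2 ^ j
    · by_contra hcon
      push Not at hcon
      apply hB₀
      refine Finset.mem_biUnion.2 ⟨j, Finset.mem_filter.2 ⟨Finset.mem_range.2 hjK, h80⟩,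
        Finset.mem_biUnion.2 ⟨S \ I, Finset.mem_image_of_mem _
          (Finset.mem_filter.2 ⟨hS, hj1, hj2.le⟩), Finset.mem_filter.2 ⟨Finset.mem_univ _, ?_⟩⟩⟩
      refine lt_of_le_of_lt ?_ hcon
      gcongr
    · have hSd : S.card ≤ d₀ := by
        have h1 : (S.card : ℝ) ≤ 160 * (K : ℝ) ^ 2 / η ^ 2 := by
          rw [le_div_iff₀ (by positivity)]
          nlinarith [sq_nonneg η, sq_pos_of_pos hη]
        exact Nat.cast_le.1 (h1.trans (Nat.le_ceil _))
      have hSI : S ⊆ I := fun x hx => Finset.mem_union_left _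
        (Finset.mem_biUnion.2 ⟨S, Finset.mem_filter.2 ⟨hS, hSd⟩, hx⟩)
      rw [Finset.sdiff_eq_empty_iff_subset.2 hSI]
      simp only [Finset.empty_inter, Finset.card_empty, Nat.cast_zero, mul_zero, sub_zero, abs_zero]
      positivity
  have hS1 : ∀ S : Finset (Fin m), ((S ∩ I).card : ℝ) + (S \ I).card = S.card := by
    intro S
    exact_mod_cast Finset.card_inter_add_card_sdiff S I
  have hsplit : ((C \ I) ∩ B₀).card + ((C \ I) \ B₀).card = (C \ I).card :=
    Finset.card_inter_add_card_sdiff _ _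
  have hCI : (C \ I).card ≤ C.card := Finset.card_le_card Finset.sdiff_subset
  -- Complementing B₀ only flips the sign of the deviation, so the smaller half of C \ I may be
  -- kept.
  rcases le_total ((C \ I) ∩ B₀).card ((C \ I) \ B₀).card with hle | hle
  · refine ⟨I, (C \ I) ∩ B₀, hIcard, ?_, by omega, fun S hS => ?_⟩
    · exact Finset.disjoint_of_subset_right Finset.inter_subset_left Finset.disjoint_sdiff
    · have h1 : S ∩ ((C \ I) ∩ B₀) = (S \ I) ∩ B₀ := by
        ext x
        have := @hC S hS x
        simp only [Finset.mem_inter, Finset.mem_sdiff]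
        tauto
      rw [h1]
      convert hdev S hS using 2
      linarith [hS1 S]
  · refine ⟨I, (C \ I) \ B₀, hIcard, ?_, by omega, fun S hS => ?_⟩
    · exact Finset.disjoint_of_subset_right Finset.sdiff_subset Finset.disjoint_sdiff
    · have h1 : S ∩ ((C \ I) \ B₀) = (S \ I) \ B₀ := by
        ext x
        have := @hC S hS x
        simp only [Finset.mem_inter, Finset.mem_sdiff]
        tauto
      have h2 : (((S \ I) ∩ B₀).card : ℝ) + ((S \ I) \ B₀).card = (S \ I).card := by
        exact_mod_cast Finset.card_inter_add_card_sdiff (S \ I) B₀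
      rw [h1, ← abs_neg]
      convert hdev S hS using 2
      linarith [hS1 S]

end Halving

/-! ### Sparsifiers by iterated halving, and the comparison of `SPR` with `NRD`. -/

section Sparsifier

variable {m : ℕ}

open Classical in
/-- Iterated halving. -/
lemma exists_weights (hm : 1 ≤ m) {K : ℕ} (hK : m < 2 ^ K) (k : ℕ) {η : ℝ} (hη : 0 < η)
    (hη1 : η ≤ 1) (l : ℕ) : ∀ (C : Finset (Fin m)) (F : Finset (Finset (Fin m))),
    C.card < 2 ^ l → NonRedundantLE F k → (∀ S ∈ F, S ⊆ C) →
    ∃ w : Fin m → ℝ≥0, ((Finset.univ.filter fun i => w i ≠ 0).card : ℝ) ≤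
      l * (33000 * k * K ^ 4 / η ^ 2) ∧ ∀ S ∈ F,
        (1 - η) ^ l * S.card ≤ ∑ i ∈ S, (w i : ℝ) ∧ ∑ i ∈ S, (w i : ℝ) ≤ (1 + η) ^ l * S.card := by
  induction l with
  | zero =>
    intro C F hC hF hFC
    refine ⟨0, by simp, fun S hS => ?_⟩
    have hC0 : C = ∅ := Finset.card_eq_zero.1 (by omega)
    have : S = ∅ := Finset.subset_empty.1 (hC0 ▸ hFC S hS)
    simp [this]
  | succ l ih =>
    intro C F hC hF hFC
    obtain ⟨I, B, hI, hIB, hB, hdev⟩ := hF.exists_halving hm hK hη hη1 C hFC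
    obtain ⟨w, hw, hwS⟩ := ih B (F.image (· ∩ B)) (by rw [pow_succ] at hC; omega) (hF.inter B) (by
      intro T hT
      obtain ⟨S, -, rfl⟩ := Finset.mem_image.1 hT
      exact Finset.inter_subset_right)
    -- Points of I keep weight 1; surviving points carry twice their recursive weight to account for
    -- the discarded half.
    refine ⟨fun i => if i ∈ I then 1 else if i ∈ B then 2 * w i else 0, ?_, ?_⟩
    · have hsub : (Finset.univ.filter fun i =>
          (if i ∈ I then 1 else if i ∈ B then 2 * w i else 0) ≠ 0) ⊆
          I ∪ Finset.univ.filter fun i => w i ≠ 0 := by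
        intro i hi
        have h := (Finset.mem_filter.1 hi).2
        by_cases hiI : i ∈ I
        · exact Finset.mem_union_left _ hiI
        · refine Finset.mem_union_right _ (Finset.mem_filter.2 ⟨Finset.mem_univ _, ?_⟩)
          intro h0
          apply h
          simp [hiI, h0]
      have h1 : ((Finset.univ.filter fun i =>
          (if i ∈ I then 1 else if i ∈ B then 2 * w i else 0) ≠ 0).card : ℝ) ≤
          I.card + (Finset.univ.filter fun i => w i ≠ 0).card := by
        exact_mod_cast (Finset.card_le_card hsub).trans (Finset.card_union_le _ _)
      push_cast
      linarith
    · intro S hS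
      have hsum : ∑ i ∈ S, (((if i ∈ I then 1 else if i ∈ B then 2 * w i else 0 : ℝ≥0)) : ℝ) =
          (S ∩ I).card + 2 * ∑ i ∈ S ∩ B, (w i : ℝ) := by
        have h1 : ∀ i ∈ S, (((if i ∈ I then 1 else if i ∈ B then 2 * w i else 0 : ℝ≥0)) : ℝ) =
            (if i ∈ I then 1 else 0) + (if i ∈ B then 2 * (w i : ℝ) else 0) := by
          intro i _
          by_cases hiI : i ∈ I
          · have : i ∉ B := Finset.disjoint_left.1 hIB hiI
            simp [hiI, this]
          · by_cases hiB : i ∈ B <;> simp [hiI, hiB]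
        rw [Finset.sum_congr rfl h1, Finset.sum_add_distrib, Finset.sum_ite_mem,
          Finset.sum_ite_mem, Finset.mul_sum]
        simp
      rw [hsum]
      obtain ⟨h1, h2⟩ := hwS _ (Finset.mem_image_of_mem (· ∩ B) hS)
      obtain ⟨h3, h4⟩ := abs_le.1 (hdev S hS)
      have hc : (0 : ℝ) ≤ (S ∩ I).card := Nat.cast_nonneg _
      constructor
      · have h5 : (1 - η) ^ l ≤ 1 := pow_le_one₀ (by linarith) (by linarith)
        have h0 : 0 ≤ (1 - η) ^ l := pow_nonneg (by linarith) _
        calc (1 - η) ^ (l + 1) * S.card = (1 - η) ^ l * (S.card - η * S.card) := by ring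
          _ ≤ (1 - η) ^ l * ((S ∩ I).card + 2 * (S ∩ B).card) := by
              gcongr
              linarith
          _ = (1 - η) ^ l * (S ∩ I).card + 2 * ((1 - η) ^ l * (S ∩ B).card) := by ring
          _ ≤ _ := by nlinarith
      · have h5 : 1 ≤ (1 + η) ^ l := one_le_pow₀ (by linarith)
        calc ((S ∩ I).card : ℝ) + 2 * ∑ i ∈ S ∩ B, (w i : ℝ)
            ≤ (1 + η) ^ l * (S ∩ I).card + 2 * ((1 + η) ^ l * (S ∩ B).card) := by
              have := mul_le_mul_of_nonneg_right h5 hc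
              linarith
          _ = (1 + η) ^ l * ((S ∩ I).card + 2 * (S ∩ B).card) := by ring
          _ ≤ (1 + η) ^ l * (S.card + η * S.card) :=
              mul_le_mul_of_nonneg_left (by linarith) (by positivity)
          _ = _ := by ring

open Classical in
/-- A family of sets has a sparsifier of size nearly linear in the size of its largest
non-redundant set. -/
theorem NonRedundantLE.exists_sparsifier {F : Finset (Finset (Fin m))} {k : ℕ}
    (hF : NonRedundantLE F k) {K : ℕ} (hK : m < 2 ^ K) {ε : ℝ} (hε : 0 < ε) (hε1 : ε < 1) :
    ∃ w : Fin m → ℝ≥0, ((Finset.univ.filter fun i => w i ≠ 0).card : ℝ) ≤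
      132000 * k * K ^ 7 / ε ^ 2 ∧ ∀ S ∈ F,
        (1 - ε) * S.card ≤ ∑ i ∈ S, (w i : ℝ) ∧ ∑ i ∈ S, (w i : ℝ) ≤ (1 + ε) * S.card := by
  rcases Nat.eq_zero_or_pos m with rfl | hm
  · refine ⟨0, ?_, fun S _ => ?_⟩
    · simp only [Pi.zero_apply, ne_eq, not_true, Finset.filter_false, Finset.card_empty,
        Nat.cast_zero]
      positivity
    · have : S = ∅ := Finset.eq_empty_of_isEmpty S
      simp [this]
  have hK1 : 1 ≤ K := by
    rcases Nat.eq_zero_or_pos K with rfl | h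
    · omega
    · exact h
  have hK1' : (1 : ℝ) ≤ K := by exact_mod_cast hK1
  have hK0 : (0 : ℝ) < K := by linarith
  -- K rounds exhaust the points since m < 2^K, and Kη = ε/2 keeps (1 ± η)^K within 1 ± ε.
  set η : ℝ := ε / (2 * K) with hη
  have hη0 : 0 < η := by positivity
  have hη1 : η ≤ 1 := by
    rw [hη, div_le_one (by positivity)]
    linarith
  have hKη : K * η = ε / 2 := by
    rw [hη]
    field_simp
  obtain ⟨w, hw, hwS⟩ := exists_weights hm hK k hη0 hη1 K Finset.univ F (by simpa using hK) hF
    (fun S _ => Finset.subset_univ S)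
  refine ⟨w, hw.trans (le_of_eq ?_), fun S hS => ?_⟩
  · rw [hη]
    field_simp
    ring
  · obtain ⟨h1, h2⟩ := hwS S hS
    have hlo : 1 - ε ≤ (1 - η) ^ K := by
      have := one_add_mul_le_pow (show (-2 : ℝ) ≤ -η by linarith) K
      rw [← sub_eq_add_neg] at this
      linarith
    have hhi : (1 + η) ^ K ≤ 1 + ε := by
      have h3 : (1 + η) ^ K ≤ Real.exp (ε / 2) := by
        rw [← hKη, Real.exp_nat_mul]
        gcongr
        linarith [Real.add_one_le_exp η]
      have h4 := (abs_le.1 (Real.abs_exp_sub_one_le (x := ε / 2)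
        (by rw [abs_of_pos (by linarith)]; linarith))).2
      rw [abs_of_pos (by linarith)] at h4
      linarith
    have hS0 : (0 : ℝ) ≤ S.card := Nat.cast_nonneg _
    exact ⟨(mul_le_mul_of_nonneg_right hlo hS0).trans h1,
      h2.trans (mul_le_mul_of_nonneg_right hhi hS0)⟩

variable {D : Type*} {r n : ℕ}

-- Clauses isolated by the sets satisfied under the complement form a non-redundant instance of R,
-- so the family theorem applies with k = `NRD R n`.
open Classical in
lemma sparsity_compl_le (R : Set (Fin r → D)) (Y : Finset (Fin r → Fin n)) {K : ℕ}
    (hK : n ^ r < 2 ^ K) {ε : ℝ} (hε : 0 < ε) (hε1 : ε < 1) :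
    (sparsity Rᶜ Y ε : ℝ) ≤ 132000 * NRD R n * K ^ 7 / ε ^ 2 := by
  let e : Y ≃ Fin Y.card := Y.equivFin
  let sat : (Fin n → D) → Finset (Fin Y.card) := fun σ =>
    Finset.univ.filter fun i => σ ∘ ((e.symm i : Y) : Fin r → Fin n) ∈ Rᶜ
  let F : Finset (Finset (Fin Y.card)) := Finset.univ.filter fun S => ∃ σ, S = sat σ
  have hcard : Y.card < 2 ^ K := by
    refine lt_of_le_of_lt ((Finset.card_le_univ Y).trans (le_of_eq ?_)) hK
    simp
  have hF : NonRedundantLE F (NRD R n) := by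
    intro I hI
    have hinj : Function.Injective fun i => ((e.symm i : Y) : Fin r → Fin n) :=
      Subtype.val_injective.comp e.symm.injective
    rw [← Finset.card_image_of_injective I hinj]
    refine IsNonRedundant.card_le_NRD ?_
    intro y hy
    obtain ⟨i, hi, rfl⟩ := Finset.mem_image.1 hy
    obtain ⟨S, hS, hSI⟩ := hI i hi
    obtain ⟨σ, rfl⟩ := (Finset.mem_filter.1 hS).2
    refine ⟨σ, ?_, ?_⟩
    · have : i ∈ sat σ ∩ I := by rw [hSI]; exact Finset.mem_singleton_self i
      exact (Finset.mem_filter.1 (Finset.mem_inter.1 this).1).2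
    · intro y' hy' hne
      obtain ⟨i', hi', rfl⟩ := Finset.mem_image.1 hy'
      by_contra hcon
      have : i' ∈ sat σ ∩ I :=
        Finset.mem_inter.2 ⟨Finset.mem_filter.2 ⟨Finset.mem_univ _, hcon⟩, hi'⟩
      rw [hSI, Finset.mem_singleton] at this
      exact hne (by rw [this])
  obtain ⟨w, hw, hwS⟩ := hF.exists_sparsifier hcard hε hε1
  have hspars : IsSparsifier Rᶜ Y ε (w ∘ e) := by
    intro σ
    have h := hwS (sat σ) (Finset.mem_filter.2 ⟨Finset.mem_univ _, σ, rfl⟩)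
    have h1 : wt Rᶜ Y σ = (sat σ).card := by
      have h0 : wt Rᶜ Y σ = (Y.filter fun y => σ ∘ y ∈ Rᶜ).card := by
        unfold wt
        congr!
      rw [h0]
      refine Finset.card_bij' (fun y hy => e ⟨y, (Finset.mem_filter.1 hy).1⟩)
        (fun i _ => ((e.symm i : Y) : Fin r → Fin n)) ?_ ?_ ?_ ?_
      · intro y hy
        refine Finset.mem_filter.2 ⟨Finset.mem_univ _, ?_⟩
        rw [Equiv.symm_apply_apply]
        exact (Finset.mem_filter.1 hy).2
      · intro i hi
        exact Finset.mem_filter.2 ⟨Subtype.prop _, (Finset.mem_filter.1 hi).2⟩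
      · intro y hy
        simp
      · intro i hi
        simp
    have h2 : weightedWt Rᶜ Y (w ∘ e) σ = ∑ i ∈ sat σ, (w i : ℝ) := by
      unfold weightedWt
      rw [Finset.sum_filter, ← Equiv.sum_comp e]
      refine Finset.sum_congr rfl fun y _ => ?_
      rw [Equiv.symm_apply_apply]
      split_ifs <;> rfl
    rw [h1, h2]
    exact h
  have hle : sparsity Rᶜ Y ε ≤ (Function.support (w ∘ e)).ncard :=
    Nat.sInf_le ⟨w ∘ e, hspars, rfl⟩
  have hnc : (Function.support (w ∘ e)).ncard = (Finset.univ.filter fun i => w i ≠ 0).card := by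
    refine (Set.ncard_image_of_injective _ e.injective).symm.trans
      (Eq.trans ?_ (Set.ncard_coe_finset _))
    congr 1
    ext i
    simp only [Set.mem_image, Function.mem_support, Function.comp_apply, Finset.coe_filter,
      Finset.mem_univ, true_and, Set.mem_ofPred_eq]
    constructor
    · rintro ⟨y, hy, rfl⟩
      exact hy
    · intro hi
      exact ⟨e.symm i, by simpa using hi, by simp⟩
  rw [hnc] at hle
  exact (Nat.cast_le.2 hle).trans hw

/-- Sparsifiability is governed by the non-redundancy of the complement. -/
lemma SPR_compl_le (R : Set (Fin r → D)) {K : ℕ} (hK : n ^ r < 2 ^ K) {ε : ℝ} (hε : 0 < ε)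
    (hε1 : ε < 1) : (SPR Rᶜ n ε : ℝ) ≤ 132000 * NRD R n * K ^ 7 / ε ^ 2 := by
  classical
  have h0 : (0 : ℝ) ≤ 132000 * NRD R n * K ^ 7 / ε ^ 2 := by positivity
  refine (Nat.cast_le.2 (Finset.sup_le (a := ⌊132000 * (NRD R n : ℝ) * K ^ 7 / ε ^ 2⌋₊)
    fun Y _ => ?_)).trans (Nat.floor_le h0)
  exact Nat.le_floor (sparsity_compl_le R Y hK hε hε1)

end Sparsifier

/-! ### Exponents strictly between 1 and 2. -/

section Exponents

open Filter Topology

/-- Constants and powers of log n are absorbed by passing from 3/2 to 5/4 and from 8/5 to 7/4. -/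
lemma one_lt_liminf_and_limsup_lt_two (g : ℕ → ℕ) {c C : ℝ} {k : ℕ} (hc : 0 < c)
    (hlow : ∀ n : ℕ, c * (n : ℝ) ^ (3 / 2 : ℝ) ≤ g n)
    (hup : ∀ n : ℕ, 2 ≤ n → (g n : ℝ) ≤ C * ((n : ℝ) ^ (8 / 5 : ℝ) * Real.log n ^ k)) :
    (1 : EReal) < liminf (fun n : ℕ => ((Real.log (g n) / Real.log n : ℝ) : EReal)) atTop ∧
      limsup (fun n : ℕ => ((Real.log (g n) / Real.log n : ℝ) : EReal)) atTop < (2 : EReal) := by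
  have e1 : ∀ᶠ n : ℕ in atTop, 1 / c ≤ (n : ℝ) ^ (1 / 4 : ℝ) :=
    ((tendsto_rpow_atTop (by norm_num : (0 : ℝ) < 1 / 4)).comp
      tendsto_natCast_atTop_atTop).eventually_ge_atTop _
  have e2 : ∀ᶠ n : ℕ in atTop, |C| * Real.log n ^ k ≤ (n : ℝ) ^ (3 / 20 : ℝ) := by
    have h1 := (isLittleO_log_rpow_rpow_atTop (k : ℝ) (by norm_num : (0 : ℝ) < 3 / 20)).comp_tendsto
      tendsto_natCast_atTop_atTop
    have h2 := h1.bound (show (0 : ℝ) < 1 / (|C| + 1) by positivity)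
    filter_upwards [h2, eventually_ge_atTop 1] with n hn hn1
    have hn1' : (1 : ℝ) ≤ n := by exact_mod_cast hn1
    have hl : 0 ≤ Real.log n := Real.log_nonneg hn1'
    simp only [Function.comp_apply, Real.rpow_natCast, Real.norm_eq_abs] at hn
    rw [abs_of_nonneg (pow_nonneg hl k), abs_of_nonneg (show (0 : ℝ) ≤ (n : ℝ) ^ (3 / 20 : ℝ) by positivity), one_div_mul_eq_div,
      le_div_iff₀ (by positivity)] at hn
    nlinarith [pow_nonneg hl k]
  have key : ∀ᶠ n : ℕ in atTop, 5 / 4 ≤ Real.log (g n) / Real.log n ∧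
      Real.log (g n) / Real.log n ≤ 7 / 4 := by
    filter_upwards [e1, e2, eventually_ge_atTop 2] with n h1 h2 hn
    have hn2 : (2 : ℝ) ≤ n := by exact_mod_cast hn
    have hn0 : (0 : ℝ) < n := by linarith
    have hlog : 0 < Real.log n := Real.log_pos (by linarith)
    have hlo : (n : ℝ) ^ (5 / 4 : ℝ) ≤ g n := by
      refine le_trans ?_ (hlow n)
      have : (n : ℝ) ^ (3 / 2 : ℝ) = (n : ℝ) ^ (1 / 4 : ℝ) * (n : ℝ) ^ (5 / 4 : ℝ) := by
        rw [← Real.rpow_add hn0]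
        norm_num
      rw [this, ← mul_assoc]
      rw [div_le_iff₀ hc] at h1
      have h3 : 0 ≤ (n : ℝ) ^ (5 / 4 : ℝ) := by positivity
      nlinarith
    have hhi : (g n : ℝ) ≤ (n : ℝ) ^ (7 / 4 : ℝ) := by
      refine (hup n hn).trans ?_
      have : (n : ℝ) ^ (7 / 4 : ℝ) = (n : ℝ) ^ (8 / 5 : ℝ) * (n : ℝ) ^ (3 / 20 : ℝ) := by
        rw [← Real.rpow_add hn0]
        norm_num
      rw [this]
      calc C * ((n : ℝ) ^ (8 / 5 : ℝ) * Real.log n ^ k)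
          ≤ |C| * ((n : ℝ) ^ (8 / 5 : ℝ) * Real.log n ^ k) := by
            gcongr
            exact le_abs_self C
        _ = (n : ℝ) ^ (8 / 5 : ℝ) * (|C| * Real.log n ^ k) := by ring
        _ ≤ _ := by gcongr
    have hgpos : (0 : ℝ) < g n := lt_of_lt_of_le (by positivity) hlo
    constructor
    · rw [le_div_iff₀ hlog, ← Real.log_rpow hn0]
      exact Real.log_le_log (by positivity) hlo
    · rw [div_le_iff₀ hlog, ← Real.log_rpow hn0]
      exact Real.log_le_log hgpos hhi
  constructor
  · refine lt_of_lt_of_le (b := ((5 / 4 : ℝ) : EReal)) ?_ ?_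
    · rw [← EReal.coe_one]
      exact EReal.coe_lt_coe (by norm_num)
    · refine le_liminf_of_le (by isBoundedDefault) ?_
      filter_upwards [key] with n hn
      exact EReal.coe_le_coe hn.1
  · refine lt_of_le_of_lt (b := ((7 / 4 : ℝ) : EReal)) ?_ ?_
    · refine limsup_le_of_le (by isBoundedDefault) ?_
      filter_upwards [key] with n hn
      exact EReal.coe_le_coe hn.2
    · have : (2 : EReal) = ((2 : ℝ) : EReal) := by norm_cast
      rw [this]
      exact EReal.coe_lt_coe (by norm_num)

end Exponents

/-! ### Explicit bounds for the predicate. -/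

section Bounds

lemma one_add_log_le {n : ℕ} (hn : 2 ≤ n) : 1 + Real.log n ≤ 3 * Real.log n := by
  have h1 : Real.log 2 ≤ Real.log n := Real.log_le_log (by norm_num) (by exact_mod_cast hn)
  have := Real.log_two_gt_d9
  linarith

lemma NRD_le_log {n : ℕ} (hn : 2 ≤ n) : (NRD (threeLinStar (ZMod 3)) n : ℝ) ≤
    54 * ((n : ℝ) ^ (8 / 5 : ℝ) * Real.log n) := by
  refine (NRD_le (by omega)).trans ?_
  calc 18 * (1 + Real.log n) * (n : ℝ) ^ (8 / 5 : ℝ)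
      ≤ 18 * (3 * Real.log n) * (n : ℝ) ^ (8 / 5 : ℝ) := by
        gcongr
        exact one_add_log_le hn
    _ = _ := by ring

lemma SPR_le_log {n : ℕ} (hn : 2 ≤ n) {ε : ℝ} (hε : 0 < ε) (hε1 : ε < 1) :
    (SPR (threeLinStar (ZMod 3))ᶜ n ε : ℝ) ≤
      132000 * 54 * 9 ^ 7 * ((n : ℝ) ^ (8 / 5 : ℝ) * Real.log n ^ 8 / ε ^ 2) := by
  -- There are at most n³ clauses, so K = 3(⌊log₂ n⌋ + 1) works, and K ≤ 9 log n for n ≥ 2.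
  have hK : n ^ 3 < 2 ^ (3 * (Nat.log 2 n + 1)) := by
    rw [mul_comm, pow_mul]
    exact Nat.pow_lt_pow_left (Nat.lt_pow_succ_log_self (by norm_num) n) (by norm_num)
  have h1 := SPR_compl_le (threeLinStar (ZMod 3)) hK hε hε1
  have hlog2 : Real.log 2 ≤ Real.log n := Real.log_le_log (by norm_num) (by exact_mod_cast hn)
  have h2 := Real.log_two_gt_d9
  have hlog : 0 ≤ Real.log n := by linarith
  have h3 : ((3 * (Nat.log 2 n + 1) : ℕ) : ℝ) ≤ 9 * Real.log n := by
    have h4 : (Nat.log 2 n : ℝ) * Real.log 2 ≤ Real.log n := by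
      rw [← Real.log_pow]
      refine Real.log_le_log (by positivity) ?_
      exact_mod_cast Nat.pow_log_le_self 2 (by omega)
    have h5 : (0 : ℝ) ≤ Nat.log 2 n := Nat.cast_nonneg _
    push_cast
    nlinarith
  calc (SPR (threeLinStar (ZMod 3))ᶜ n ε : ℝ)
      ≤ 132000 * (54 * ((n : ℝ) ^ (8 / 5 : ℝ) * Real.log n)) * (9 * Real.log n) ^ 7 / ε ^ 2 := by
        refine h1.trans ?_
        gcongr
        exact NRD_le_log hn
    _ = _ := by ring

lemma le_NRD (n : ℕ) :
    1 / 42 * (n : ℝ) ^ (3 / 2 : ℝ) ≤ (NRD (threeLinStar (ZMod 3)) n : ℝ) := by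
  obtain ⟨Y, hY, h⟩ := exists_isNonRedundant_rpow n
  exact h.trans (Nat.cast_le.2 hY.card_le_NRD)

lemma le_SPR (n : ℕ) {ε : ℝ} (hε : 0 < ε) (hε1 : ε < 1) :
    1 / 42 * (n : ℝ) ^ (3 / 2 : ℝ) ≤ (SPR (threeLinStar (ZMod 3))ᶜ n ε : ℝ) := by
  obtain ⟨Y, hY, h⟩ := exists_isNonRedundant_rpow n
  exact h.trans (Nat.cast_le.2 (hY.card_le_SPR hε hε1))

end Bounds

end CSP

theorem theorem3 :
    -- `NRD` is `Ω(n ^ 1.5)`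
    (∃ c : ℝ, 0 < c ∧ ∀ n : ℕ,
      c * (n : ℝ) ^ (3 / 2 : ℝ) ≤ (CSP.NRD (CSP.threeLinStar (ZMod 3)) n : ℝ)) ∧
    -- `NRD` is `O(n ^ 1.6 * polylog n)`
    (∃ (C : ℝ) (k : ℕ), ∀ n : ℕ, 2 ≤ n →
      (CSP.NRD (CSP.threeLinStar (ZMod 3)) n : ℝ) ≤
        C * ((n : ℝ) ^ (8 / 5 : ℝ) * Real.log n ^ k)) ∧
    -- `SPR` of the complement is `Ω(n ^ 1.5)`, uniformly in `ε`
    (∃ c : ℝ, 0 < c ∧ ∀ (n : ℕ) (ε : ℝ), 0 < ε → ε < 1 →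
      c * (n : ℝ) ^ (3 / 2 : ℝ) ≤ (CSP.SPR (CSP.threeLinStar (ZMod 3))ᶜ n ε : ℝ)) ∧
    -- `SPR` of the complement is `O(n ^ 1.6 * polylog n / ε ^ 2)`, uniformly in `ε`
    (∃ (C : ℝ) (k : ℕ), ∀ (n : ℕ) (ε : ℝ), 2 ≤ n → 0 < ε → ε < 1 →
      (CSP.SPR (CSP.threeLinStar (ZMod 3))ᶜ n ε : ℝ) ≤
        C * ((n : ℝ) ^ (8 / 5 : ℝ) * Real.log n ^ k / ε ^ 2)) ∧
    -- the exponent of `NRD` lies strictly between `1` and `2`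
    ((1 : EReal) < Filter.liminf (fun n : ℕ =>
        ((Real.log (CSP.NRD (CSP.threeLinStar (ZMod 3)) n) / Real.log n : ℝ) : EReal))
        Filter.atTop ∧
      Filter.limsup (fun n : ℕ =>
        ((Real.log (CSP.NRD (CSP.threeLinStar (ZMod 3)) n) / Real.log n : ℝ) : EReal))
        Filter.atTop < (2 : EReal)) ∧
    -- for each fixed `ε`, so does the exponent of `SPR` of the complement
    (∀ ε : ℝ, 0 < ε → ε < 1 →
      (1 : EReal) < Filter.liminf (fun n : ℕ =>
        ((Real.log (CSP.SPR (CSP.threeLinStar (ZMod 3))ᶜ n ε) / Real.log n : ℝ) : EReal))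
        Filter.atTop ∧
      Filter.limsup (fun n : ℕ =>
        ((Real.log (CSP.SPR (CSP.threeLinStar (ZMod 3))ᶜ n ε) / Real.log n : ℝ) : EReal))
        Filter.atTop < (2 : EReal)) := by
  have hNRD : ∀ n : ℕ, 2 ≤ n → (CSP.NRD (CSP.threeLinStar (ZMod 3)) n : ℝ) ≤
      54 * ((n : ℝ) ^ (8 / 5 : ℝ) * Real.log n ^ 1) := fun n hn => by
    rw [pow_one]
    exact CSP.NRD_le_log hn
  refine ⟨⟨1 / 42, by norm_num, CSP.le_NRD⟩, ⟨54, 1, hNRD⟩,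
    ⟨1 / 42, by norm_num, fun n ε h0 h1 => CSP.le_SPR n h0 h1⟩,
    ⟨132000 * 54 * 9 ^ 7, 8, fun n ε hn h0 h1 => CSP.SPR_le_log hn h0 h1⟩,
    CSP.one_lt_liminf_and_limsup_lt_two _ (by norm_num) CSP.le_NRD hNRD, fun ε h0 h1 => ?_⟩
  refine CSP.one_lt_liminf_and_limsup_lt_two (fun n => CSP.SPR (CSP.threeLinStar (ZMod 3))ᶜ n ε)
    (c := 1 / 42) (C := 132000 * 54 * 9 ^ 7 / ε ^ 2) (k := 8) (by norm_num)
    (fun n => CSP.le_SPR n h0 h1) fun n hn => ?_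
  refine (CSP.SPR_le_log hn h0 h1).trans (le_of_eq ?_)
  ring
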